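/- **Setting.** Let $M$ be a non-empty metric space with metric $d$ in which closed bounded sets are compact. Let $T$ be a non-compact metrisable topological group acting on $M$ from the left, continuously, properly and by isometries of $d$. Assume that $T$ is unimodular, and let $\mathrm{vol}$ be a left Haar measure on $T$ (it is also right invariant). Fix $r>0$ and let $\mathcal P_r(M)$ be the collection of all $P\subseteq M$ such that every open ball of radius $r$ contains at most one point of $P$. Give $\mathcal P_r(M)$ the vague topology, i.e. the coarsest topology for which $P\mapsto\sum_{p\in P}\varphi(p)$ is continuous for every $\varphi\in C_c(M)$, and let $T$ act on it by $xP=\{xp:p\in P\}$. **Van Hove sequences.** A van Hove sequence is an increasing sequence $(D_n)_n$ of non-empty compact subsets of $T$ such that $\bigcup_n \mathring D_n=T$ and such that $\mathrm{vol}(\partial^K D_n)/\mathrm{vol}(D_n)\to0$ for every compact $K\subseteq T$, where $\partial^K D:=\big((KD)\setminus\mathring D\big)\cup\big((K\overline{D^c})\setminus D^c\big)$. **Patterns and finite local complexity.** A pattern of $P$ is a finite subset of $P$; a pattern of $\mathcal P\subseteq\mathcal P_r(M)$ is a pattern of some $P\in\mathcal P$. A support of a pattern $Q$ of $P$ is a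 compact set $V\subseteq M$ with $Q=P\cap\mathring V$. Two subsets $A,A'$ of $M$ are equivalent if $xA=A'$ for some $x\in T$. The collection $\mathcal P$ has finite local complexity (FLC) if for every compact $V\subseteq M$ there is a finite set $\mathcal F$ of patterns of $\mathcal P$ such that every pattern of $\mathcal P$ that admits a support equivalent to $V$ is equivalent to some element of $\mathcal F$. **Proposition 2.16.** Let $(D_n)_n$ be a van Hove sequence in $T$ and let $\mathcal P\subseteq\mathcal P_r(M)$ be non-empty and of finite local complexity. Let $X_{\mathcal P}$ be the closure of $\{xP:x\in T,\ P\in\mathcal P\}$ in $\mathcal P_r(M)$. Then the following are equivalent. 1. $X_{\mathcal P}$ is uniquely ergodic, i.e. it carries exactly one $T$-invariant Borel probability measure. 2. $\mathcal P$ has uniform pattern frequencies, i.e. for every pattern $Q$ of $\mathcal P$ the sequence $$\nu_n^{y,P}(Q):=\frac{\mathrm{card}\{\widetilde Q\subseteq P:\ \exists x\in D_ny:\ x\widetilde Q=Q\}}{\mathrm{vol}(D_n)}$$ converges, as $n\to\infty$, uniformly in $(y,P)\in T\times\mathcal P$ to a limit that is independent of $(y,P)$. -/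

import Mathlib

open Set Filter Topology MeasureTheory
open scoped Pointwise CompactlySupported

noncomputable section

/-! ### Uniformly discrete point sets and the vague topology -/

/-- The collection of all subsets of the metric space `M` that are uniformly discrete of radius
`r`: every open ball of radius `r` contains at most one element of the set. -/
def PointSet (M : Type*) [MetricSpace M] (r : ℝ) : Type _ :=
  {P : Set M // ∀ m : M, (P ∩ Metric.ball m r).Subsingleton}

namespace PointSet

section Vague

variable {M : Type*} [MetricSpace M] {r : ℝ}

/-- The underlying set of points. -/
def points (P : PointSet M r) : Set M := P.1

/-- The function `P ↦ ∑_{p ∈ P} φ(p)`. In a proper metric space only finitely many terms are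
nonzero, so the sum is a finite sum. -/
def eval (φ : C_c(M, ℝ)) (P : PointSet M r) : ℝ := ∑ᶠ p ∈ P.points, φ p

/-- The vague topology: the coarsest topology for which all the maps `eval φ`, with `φ`
continuous and compactly supported, are continuous. -/
instance : TopologicalSpace (PointSet M r) :=
  ⨅ φ : C_c(M, ℝ), TopologicalSpace.induced (eval φ) inferInstance

/-- Point sets carry the Borel sigma-algebra of the vague topology. -/
instance : MeasurableSpace (PointSet M r) := borel _

instance : BorelSpace (PointSet M r) := ⟨rfl⟩

theorem continuous_eval (φ : C_c(M, ℝ)) :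
    Continuous (eval φ : PointSet M r → ℝ) :=
  continuous_iInf_dom (i := φ) continuous_induced_dom

end Vague

section Action

variable {T M : Type*} [Group T] [MetricSpace M] [MulAction T M] [IsIsometricSMul T M] {r : ℝ}

/-- The induced action on point sets, `xP = {xp : p ∈ P}`. -/
instance : MulAction T (PointSet M r) where
  smul x P := ⟨x • P.1, by
    intro m a ha b hb
    obtain ⟨⟨p, hp, rfl⟩, ha⟩ := ha
    obtain ⟨⟨q, hq, rfl⟩, hb⟩ := hb
    have key : ∀ s : M, x • s ∈ Metric.ball m r → s ∈ Metric.ball (x⁻¹ • m) r := by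
      intro s hs
      rw [Metric.mem_ball] at hs ⊢
      rwa [← dist_smul x, smul_inv_smul]
    have h : p = q := P.2 (x⁻¹ • m) ⟨hp, key p ha⟩ ⟨hq, key q hb⟩
    rw [h]⟩
  one_smul P := Subtype.ext (one_smul T P.1)
  mul_smul x y P := Subtype.ext (mul_smul x y P.1)

@[simp] theorem points_smul (x : T) (P : PointSet M r) : (x • P).points = x • P.points := rfl

theorem eval_smul [TopologicalSpace T] [ContinuousSMul T M] (φ : C_c(M, ℝ)) (x : T) :
    ∃ ψ : C_c(M, ℝ), ∀ P : PointSet M r, eval φ (x • P) = eval ψ P := by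
  refine ⟨⟨φ.toContinuousMap.comp ⟨fun m => x • m, continuous_const_smul x⟩,
    φ.hasCompactSupport.comp_homeomorph (Homeomorph.smul x)⟩, fun P => ?_⟩
  unfold eval
  rw [points_smul, ← Set.image_smul, finsum_mem_image (MulAction.injective x).injOn]
  rfl

instance [TopologicalSpace T] [ContinuousSMul T M] :
    ContinuousConstSMul T (PointSet M r) where
  continuous_const_smul x := by
    refine continuous_iInf_rng.2 fun φ => continuous_induced_rng.2 ?_
    obtain ⟨ψ, hψ⟩ := eval_smul (r := r) φ x
    have : (eval φ ∘ fun P : PointSet M r => x • P) = eval ψ := funext hψ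
    rw [this]
    exact continuous_eval ψ

end Action

end PointSet

/-! ### The hull and unique ergodicity -/

/-- The closed orbit `X_Ps`, the closure of `{xP : x ∈ T, P ∈ Ps}` in the vague topology, as a
`T`-invariant set. -/
def hull (T : Type*) {M : Type*} [Group T] [TopologicalSpace T] [MetricSpace M] [MulAction T M]
    [IsIsometricSMul T M] [ContinuousSMul T M] {r : ℝ} (Ps : Set (PointSet M r)) :
    SubMulAction T (PointSet M r) where
  carrier := closure {R | ∃ x : T, ∃ P ∈ Ps, R = x • P}
  smul_mem' y R hR := by
    refine map_mem_closure (continuous_const_smul y) hR ?_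
    rintro _ ⟨x, P, hP, rfl⟩
    exact ⟨y * x, P, hP, (mul_smul y x P).symm⟩

/-- A dynamical system is uniquely ergodic if it carries exactly one invariant probability
measure. -/
def UniquelyErgodic (T X : Type*) [SMul T X] [MeasurableSpace X] : Prop :=
  ∃! μ : Measure X, IsProbabilityMeasure μ ∧ SMulInvariantMeasure T X μ

/-! ### Van Hove sequences -/

section VanHove

variable {T : Type*} [Group T] [TopologicalSpace T]

/-- The van Hove boundary `∂ᴷ D`. -/
def vanHoveBoundary (K D : Set T) : Set T :=
  (K * D) \ interior D ∪ (K * closure Dᶜ) \ Dᶜ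

/-- Van Hove sequences with respect to a (Haar) measure `vol`. -/
structure IsVanHove [MeasurableSpace T] (vol : Measure T) (D : ℕ → Set T) : Prop where
  monotone : Monotone D
  nonempty : ∀ n, (D n).Nonempty
  isCompact : ∀ n, IsCompact (D n)
  iUnion_interior : ⋃ n, interior (D n) = univ
  tendsto_boundary : ∀ K : Set T, IsCompact K →
    Tendsto (fun n => vol.real (vanHoveBoundary K (D n)) / vol.real (D n)) atTop (𝓝 0)

end VanHove

/-! ### Patterns, finite local complexity, pattern frequencies -/

section Patterns

variable {M : Type*} [MetricSpace M] {r : ℝ}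

/-- A pattern of the point set `P` is a finite subset of `P`. -/
def IsPatternOf (P : PointSet M r) (Q : Set M) : Prop :=
  Q.Finite ∧ Q ⊆ P.points

/-- A pattern of a collection of point sets is a pattern of one of its members. -/
def IsPattern (Ps : Set (PointSet M r)) (Q : Set M) : Prop :=
  ∃ P ∈ Ps, IsPatternOf P Q

/-- The compact set `V` is a support of the pattern `Q` of `P`. -/
def IsSupport (P : PointSet M r) (Q V : Set M) : Prop :=
  IsCompact V ∧ Q = P.points ∩ interior V

/-- Two subsets of `M` are equivalent if they differ by the action of a group element. -/
def AreEquivalent (T : Type*) {M : Type*} [Group T] [MulAction T M] (V V' : Set M) : Prop :=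
  ∃ x : T, x • V = V'

/-- Finite local complexity: for every compact `V` there is a finite collection of patterns of
`Ps` such that every pattern of `Ps` which admits a support equivalent to `V` is equivalent to a
pattern in this collection. -/
def HasFLC (T : Type*) [Group T] [MulAction T M] (Ps : Set (PointSet M r)) : Prop :=
  ∀ V : Set M, IsCompact V → ∃ F : Set (Set M), F.Finite ∧ (∀ Q ∈ F, IsPattern Ps Q) ∧
    ∀ P ∈ Ps, ∀ Q V' : Set M, IsPatternOf P Q → IsSupport P Q V' → AreEquivalent T V V' →
      ∃ Q' ∈ F, AreEquivalent T Q Q'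

variable {T : Type*} [Group T] [MulAction T M] [MeasurableSpace T]

/-- The normalised count `card {Q' ⊆ P : ∃ x ∈ D y, xQ' = Q} / vol(D)`. -/
def patternFreq (vol : Measure T) (D : Set T) (Q : Set M) (y : T) (P : PointSet M r) : ℝ :=
  ({Q' : Set M | Q' ⊆ P.points ∧ ∃ x ∈ D * {y}, x • Q' = Q}.ncard : ℝ) / vol.real D

/-- Uniform pattern frequencies along the sequence `D`: for every pattern `Q` of `Ps`, the
normalised counts converge uniformly in `(y, P) ∈ T × Ps` to a limit that does not depend on
`(y, P)`. -/
def HasUniformPatternFrequencies (vol : Measure T) (D : ℕ → Set T)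
    (Ps : Set (PointSet M r)) : Prop :=
  ∀ Q : Set M, IsPattern Ps Q → ∃ ν : ℝ,
    TendstoUniformlyOn (fun n (yP : T × PointSet M r) => patternFreq vol (D n) Q yP.1 yP.2)
      (fun _ => ν) atTop (univ ×ˢ Ps)

end Patterns

end

/-!
The space of uniformly discrete sets is compact and metrizable in the vague topology, and `T` acts
on it continuously. For such a system unique ergodicity is equivalent to the convergence of the
averages `orbitAverage vol (D n) f`, uniformly to a constant, for enough continuous functions `f`:
limits of averages along ultrafilters are invariant measures
(`IsVanHove.exists_invariant_measure`), so unique ergodicity forces uniform convergence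
(`UniquelyErgodic.tendstoUniformly_orbitAverage`), and conversely the limits determine the
integrals of an invariant measure by Fubini (`IsVanHove.uniquelyErgodic_of_tendstoUniformlyOn`).

The functions used are `P ↦ ∑ h(p)`, with `h` continuous and compactly supported on `ι → M` and
`p` ranging over the `ι`-tuples of points of `P`. They are continuous because the set of tuples of
`P` is itself uniformly discrete and depends continuously on `P` (`PointSet.continuous_tuples`).
Grouping the tuples by their range turns such a sum into a sum over finite subsets of `P`. If
these subsets fall into finitely many orbits, with representatives `Q`, then the average over
`D n` is asymptotically `∑ Q, c Q * patternFreq vol (D n) Q`, where `c Q` is the integral of the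
summand over the orbit of `Q`: only the subsets moved across the boundary of `D n` are counted
wrongly, and their number is at most a constant times the volume of a van Hove boundary
(`IsVanHove.tendstoUniformlyOn_orbitAverage_sub`). Right invariance of the Haar measure makes the
constants `c Q` independent of the subset counted.

If pattern frequencies exist uniformly, finite local complexity provides the finitely many orbits,
so the averages converge for all products of evaluations `PointSet.eval φ`, which span a
separating algebra. If the hull is uniquely ergodic and `Q` is a nonempty pattern, finite local
complexity and the closedness of orbits of tuples give an `h` that sees only the copies of `Q`
(`HasFLC.exists_isolating`), with `c Q > 0`; the averages converge uniformly, hence so does the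
frequency of `Q`. The empty pattern has frequency `1 / vol (D n) → 0`, since `T` is not compact.
-/

open Set Filter Topology MeasureTheory
open scoped Pointwise CompactlySupported

/-! ### The vague topology on uniformly discrete sets -/

namespace PointSet

section VagueTopology

variable {M : Type*} [MetricSpace M] {r : ℝ}

theorem ext_points {P P' : PointSet M r} (h : P.points = P'.points) : P = P' := Subtype.ext h

theorem eq_of_mem_ball (P : PointSet M r) {m a b : M} (ha : a ∈ P.points) (hb : b ∈ P.points)
    (ham : a ∈ Metric.ball m r) (hbm : b ∈ Metric.ball m r) : a = b :=
  P.2 m ⟨ha, ham⟩ ⟨hb, hbm⟩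

/-- A compact set meets all uniformly discrete sets of a given radius in boundedly many points. -/
theorem exists_ncard_inter_le (hr : 0 < r) {K : Set M} (hK : IsCompact K) :
    ∃ N : ℕ, ∀ P : PointSet M r, (P.points ∩ K).Finite ∧ (P.points ∩ K).ncard ≤ N := by
  obtain ⟨t, -, htf, htK⟩ := hK.finite_cover_balls hr
  have hc : ∀ x ∈ K, ∃ c ∈ t, x ∈ Metric.ball c r := fun x hx => by simpa using htK hx
  choose! c hct hcb using hc
  refine ⟨t.ncard, fun P => ?_⟩
  have hmaps : MapsTo c (P.points ∩ K) t := fun x hx => hct x hx.2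
  have hinj : InjOn c (P.points ∩ K) := fun x hx y hy hxy =>
    P.eq_of_mem_ball hx.1 hy.1 (hcb x hx.2) (hxy ▸ hcb y hy.2)
  exact ⟨Set.Finite.of_injOn hmaps hinj htf, Set.ncard_le_ncard_of_injOn c hmaps hinj htf⟩

theorem finite_inter (hr : 0 < r) (P : PointSet M r) {K : Set M} (hK : IsCompact K) :
    (P.points ∩ K).Finite :=
  ((exists_ncard_inter_le hr hK).choose_spec P).1

theorem eval_eq_sum {φ : C_c(M, ℝ)} {P : PointSet M r} (F : Finset M)
    (hF : ∀ p ∈ F, p ∈ P.points) (hφ : ∀ p ∈ P.points, φ p ≠ 0 → p ∈ F) :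
    eval φ P = ∑ p ∈ F, φ p := by
  refine finsum_mem_eq_sum_of_inter_support_eq _ ?_
  ext p
  simp only [mem_inter_iff, Function.mem_support, Finset.mem_coe]
  exact ⟨fun h => ⟨hφ p h.1 h.2, h.2⟩, fun h => ⟨hF p h.1, h.2⟩⟩

theorem exists_finset_eval (hr : 0 < r) (P : PointSet M r) {K : Set M} (hK : IsCompact K) :
    ∃ F : Finset M, (∀ p, p ∈ F ↔ p ∈ P.points ∧ p ∈ K) ∧
      ∀ φ : C_c(M, ℝ), (∀ p, φ p ≠ 0 → p ∈ K) → eval φ P = ∑ p ∈ F, φ p := by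
  refine ⟨(P.finite_inter hr hK).toFinset, fun p => by simp, fun φ hφ => ?_⟩
  exact eval_eq_sum _ (fun p hp => ((Set.Finite.mem_toFinset _).1 hp).1)
    fun p hp h => (Set.Finite.mem_toFinset _).2 ⟨hp, hφ p h⟩

theorem mem_tsupport_of_ne {φ : C_c(M, ℝ)} {p : M} (h : φ p ≠ 0) : p ∈ tsupport φ :=
  subset_tsupport _ h

variable {α : Type*}

/-- The limit of a family of uniformly discrete sets along an ultrafilter: the points all of whose
neighbourhoods are eventually met. -/
def ultralimit (U : Ultrafilter α) (f : α → PointSet M r) : PointSet M r :=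
  ⟨{m | ∀ ε > 0, ∀ᶠ a in U, ((f a).points ∩ Metric.ball m ε).Nonempty}, by
    rintro m a ⟨ha, ham⟩ b ⟨hb, hbm⟩
    by_contra hab
    have hd : 0 < dist a b := dist_pos.2 hab
    rw [Metric.mem_ball] at ham hbm
    set ε := min (dist a b / 2) (min (r - dist a m) (r - dist b m)) with hε
    have hε0 : 0 < ε := by
      refine lt_min (by linarith) (lt_min ?_ ?_) <;> linarith
    have h1 : ε ≤ dist a b / 2 := min_le_left _ _
    have h2 : ε ≤ r - dist a m := (min_le_right _ _).trans (min_le_left _ _)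
    have h3 : ε ≤ r - dist b m := (min_le_right _ _).trans (min_le_right _ _)
    obtain ⟨i, ⟨a', ha', haa⟩, ⟨b', hb', hbb⟩⟩ := ((ha ε hε0).and (hb ε hε0)).exists
    rw [Metric.mem_ball] at haa hbb
    have : a' = b' := (f i).eq_of_mem_ball (m := m) ha' hb'
      (by rw [Metric.mem_ball]; linarith [dist_triangle a' a m])
      (by rw [Metric.mem_ball]; linarith [dist_triangle b' b m])
    subst this
    linarith [dist_triangle a a' b, dist_comm a a']⟩

/-- A test function supported in a ball of radius `r` sees at most one point of each set. Either
eventually no point lies in its support, or these points converge by compactness. -/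
theorem tendsto_eval_ultralimit_of_tsupport_subset_ball (U : Ultrafilter α)
    (f : α → PointSet M r) (φ : C_c(M, ℝ)) {m : M} (hφ : tsupport φ ⊆ Metric.ball m r) :
    Tendsto (fun a => eval φ (f a)) U (𝓝 (eval φ (ultralimit U f))) := by
  by_cases h : ∀ᶠ a in U, ((f a).points ∩ tsupport φ).Nonempty
  · obtain ⟨a₀, p₀, -⟩ := h.exists
    have hex : ∃ p : α → M, ∀ᶠ a in U, p a ∈ (f a).points ∧ p a ∈ tsupport φ :=
      ⟨fun a => Classical.epsilon (h := ⟨p₀⟩) fun x => x ∈ (f a).points ∧ x ∈ tsupport φ,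
        h.mono fun a ha => Classical.epsilon_spec ha⟩
    obtain ⟨p, hp⟩ := hex
    obtain ⟨q, hq, hlim⟩ := isCompact_iff_ultrafilter_le_nhds.1 φ.hasCompactSupport (U.map p)
      (by rw [le_principal_iff]; exact hp.mono fun a ha => ha.2)
    have hlim : Tendsto p U (𝓝 q) := hlim
    have hqL : q ∈ (ultralimit U f).points := fun ε hε => by
      filter_upwards [hp, hlim (Metric.ball_mem_nhds q hε)] with a ha ha'
      exact ⟨p a, ha.1, ha'⟩
    have key : ∀ (P : PointSet M r) (x : M), x ∈ P.points → x ∈ tsupport φ →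
        eval φ P = φ x := fun P x hx hxφ => by
      rw [eval_eq_sum {x} (by simpa using hx), Finset.sum_singleton]
      intro y hy hyφ
      rw [Finset.mem_singleton]
      exact P.eq_of_mem_ball hy hx (hφ (mem_tsupport_of_ne hyφ)) (hφ hxφ)
    rw [key _ q hqL hq]
    refine ((φ.continuous.tendsto q).comp hlim).congr' ?_
    filter_upwards [hp] with a ha
    exact (key _ _ ha.1 ha.2).symm
  · rw [← Ultrafilter.eventually_not] at h
    have key : ∀ P : PointSet M r, (∀ p ∈ P.points, φ p = 0) → eval φ P = 0 := fun P hP => by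
      rw [eval_eq_sum ∅ (by simp) fun p hp h => (h (hP p hp)).elim, Finset.sum_empty]
    have h0 : eval φ (ultralimit U f) = 0 := key _ fun p hp => by
      by_contra hne
      obtain ⟨ε, hε, hb⟩ := Metric.mem_nhds_iff.1 (φ.continuous.isOpen_support.mem_nhds hne)
      obtain ⟨a, ⟨x, hx, hxb⟩, ha⟩ := ((hp ε hε).and h).exists
      exact ha ⟨x, hx, subset_tsupport _ (hb hxb)⟩
    rw [h0]
    refine tendsto_const_nhds.congr' ?_
    filter_upwards [h] with a ha
    refine (key _ fun p hp => ?_).symm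
    by_contra hne
    exact ha ⟨p, hp, mem_tsupport_of_ne hne⟩

variable [ProperSpace M]

/-- A test function splits by a partition of unity into summands supported in balls of radius
`r`. -/
theorem tendsto_eval_ultralimit (hr : 0 < r) (U : Ultrafilter α)
    (f : α → PointSet M r) (φ : C_c(M, ℝ)) :
    Tendsto (fun a => eval φ (f a)) U (𝓝 (eval φ (ultralimit U f))) := by
  have hK : IsCompact (tsupport φ) := φ.hasCompactSupport
  obtain ⟨t, -, htf, htK⟩ := hK.finite_cover_balls hr
  obtain ⟨n, c, hc⟩ := htf.fin_param
  obtain ⟨g, hg, hg1, -, -⟩ := exists_continuous_sum_one_of_isOpen_isCompact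
    (s := fun i : Fin n => Metric.ball (c i) r) (fun i => Metric.isOpen_ball) hK (by
      intro x hx
      obtain ⟨y, hy, hxy⟩ := mem_iUnion₂.1 (htK hx)
      rw [← hc.2] at hy
      obtain ⟨i, rfl⟩ := hy
      exact mem_iUnion.2 ⟨i, hxy⟩)
  let ψ : Fin n → C_c(M, ℝ) := fun i => ⟨g i * φ.toContinuousMap, φ.hasCompactSupport.mul_left⟩
  have hψ : ∀ i x, ψ i x = g i x * φ x := fun _ _ => rfl
  have hsum : ∀ P : PointSet M r, eval φ P = ∑ i, eval (ψ i) P := fun P => by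
    obtain ⟨F, hF, hFe⟩ := P.exists_finset_eval hr hK
    rw [hFe φ fun p => mem_tsupport_of_ne, Finset.sum_congr rfl fun i _ => hFe (ψ i) fun p hp =>
      mem_tsupport_of_ne fun h => hp (by rw [hψ, h, mul_zero]), Finset.sum_comm]
    refine Finset.sum_congr rfl fun p hp => ?_
    have := hg1 ((hF p).1 hp).2
    simp only [Finset.sum_apply, Pi.one_apply] at this
    simp_rw [hψ, ← Finset.sum_mul, this, one_mul]
  simp_rw [hsum]
  refine tendsto_finsetSum _ fun i _ =>
    tendsto_eval_ultralimit_of_tsupport_subset_ball U f (ψ i) (m := c i) ?_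
  exact (tsupport_mul_subset_left (f := g i) (g := φ)).trans (hg i)

theorem tendsto_ultralimit (hr : 0 < r) (U : Ultrafilter α) (f : α → PointSet M r) :
    Tendsto f U (𝓝 (ultralimit U f)) := by
  rw [nhds_iInf, tendsto_iInf]
  intro φ
  rw [nhds_induced, tendsto_comap_iff]
  exact tendsto_eval_ultralimit hr U f φ

theorem compactSpace (hr : 0 < r) : CompactSpace (PointSet M r) where
  isCompact_univ := isCompact_iff_ultrafilter_le_nhds.2 fun U _ =>
    ⟨ultralimit U id, mem_univ _, tendsto_ultralimit hr U id⟩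

/-- The tent function `x ↦ max (ρ - d(x, m)) 0`. -/
noncomputable def tent (m : M) (ρ : ℝ) : C_c(M, ℝ) where
  toFun x := max (ρ - dist x m) 0
  continuous_toFun := by fun_prop
  hasCompactSupport' := HasCompactSupport.intro (isCompact_closedBall m ρ) fun x hx => by
    rw [Metric.mem_closedBall, not_le] at hx
    exact max_eq_right (by linarith)

theorem tent_nonneg (m : M) (ρ : ℝ) (x : M) : 0 ≤ tent m ρ x := le_max_right _ _

theorem tent_ne_zero_iff {m : M} {ρ : ℝ} {x : M} : tent m ρ x ≠ 0 ↔ x ∈ Metric.ball m ρ := by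
  change max (ρ - dist x m) 0 ≠ 0 ↔ _
  rw [Metric.mem_ball, ne_eq, max_eq_right_iff, not_le, sub_pos]

theorem eval_tent_ne_zero_iff (hr : 0 < r) (P : PointSet M r) (m : M) (ρ : ℝ) :
    eval (tent m ρ) P ≠ 0 ↔ (P.points ∩ Metric.ball m ρ).Nonempty := by
  obtain ⟨F, hF, hFe⟩ := P.exists_finset_eval hr (tent m ρ).hasCompactSupport
  rw [hFe _ fun p => mem_tsupport_of_ne, ne_eq,
    Finset.sum_eq_zero_iff_of_nonneg fun p _ => tent_nonneg m ρ p]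
  push Not
  constructor
  · rintro ⟨p, hp, h⟩
    exact ⟨p, ((hF p).1 hp).1, tent_ne_zero_iff.1 h⟩
  · rintro ⟨p, hp, h⟩
    exact ⟨p, (hF p).2 ⟨hp, mem_tsupport_of_ne (tent_ne_zero_iff.2 h)⟩, tent_ne_zero_iff.2 h⟩

theorem isClosed_points (hr : 0 < r) (P : PointSet M r) : IsClosed P.points := by
  refine isClosed_of_closure_subset fun m hm => ?_
  have hfin := P.finite_inter hr (isCompact_closedBall m 1)
  have : m ∈ closure (P.points ∩ Metric.closedBall m 1) := by
    rw [Metric.mem_closure_iff] at hm ⊢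
    intro ε hε
    obtain ⟨b, hb, hmb⟩ := hm (min ε 1) (lt_min hε one_pos)
    exact ⟨b, ⟨hb, Metric.mem_closedBall'.2 (hmb.le.trans (min_le_right _ _))⟩,
      hmb.trans_le (min_le_left _ _)⟩
  rw [hfin.isClosed.closure_eq] at this
  exact this.1

/-- A uniformly discrete set is determined by the values of countably many tent functions, as soon
as `s` is countable; this yields metrizability. -/
theorem exists_dense_separating (hr : 0 < r) {s : Set M} (hs : Dense s) {P P' : PointSet M r}
    (h : ∀ m ∈ s, ∀ n : ℕ, eval (tent m (1 / (n + 1))) P = eval (tent m (1 / (n + 1))) P') :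
    P = P' := by
  have key : ∀ P P' : PointSet M r,
      (∀ m ∈ s, ∀ n : ℕ, eval (tent m (1 / (n + 1))) P = eval (tent m (1 / (n + 1))) P') →
      P.points ⊆ P'.points := by
    intro P P' h p hp
    by_contra hp'
    obtain ⟨ε, hε, hb⟩ := Metric.mem_nhds_iff.1 ((P'.isClosed_points hr).isOpen_compl.mem_nhds hp')
    obtain ⟨n, hn⟩ := exists_nat_one_div_lt (half_pos hε)
    obtain ⟨m, hm, hpm⟩ := hs.exists_dist_lt p (Nat.one_div_pos_of_nat (α := ℝ) (n := n))
    have h1 := (eval_tent_ne_zero_iff hr P m (1 / (n + 1))).2 ⟨p, hp, hpm⟩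
    rw [h m hm n, eval_tent_ne_zero_iff hr] at h1
    obtain ⟨x, hx, hxm⟩ := h1
    rw [Metric.mem_ball] at hxm
    refine hb (Metric.mem_ball.2 ?_) hx
    linarith [dist_triangle x m p, dist_comm p m]
  exact ext_points ((key P P' h).antisymm (key P' P fun m hm n => (h m hm n).symm))

theorem t2Space (hr : 0 < r) : T2Space (PointSet M r) :=
  T2Space.of_injective_continuous (f := fun P (φ : C_c(M, ℝ)) => eval φ P)
    (fun _ _ h => exists_dense_separating hr dense_univ fun _ _ _ => congr_fun h _)
    (continuous_pi continuous_eval)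

theorem metrizableSpace (hr : 0 < r) : TopologicalSpace.MetrizableSpace (PointSet M r) := by
  have := compactSpace (M := M) hr
  obtain ⟨s, hsc, hs⟩ := TopologicalSpace.exists_countable_dense M
  have := hsc.to_subtype
  have hc : Continuous fun (P : PointSet M r) (i : s × ℕ) =>
      eval (tent i.1.1 (1 / (i.2 + 1))) P := continuous_pi fun _ => continuous_eval _
  exact (hc.isClosedEmbedding fun _ _ h => exists_dense_separating hr hs fun m hm n =>
    congr_fun h (⟨m, hm⟩, n)).isEmbedding.metrizableSpace

/-- Convergence along an ultrafilter, described by the points whose neighbourhoods are met. -/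
theorem tendsto_ultrafilter_iff (hr : 0 < r) {U : Ultrafilter α} {f : α → PointSet M r}
    {P : PointSet M r} : Tendsto f U (𝓝 P) ↔ ∀ m, m ∈ P.points ↔
      ∀ ε > 0, ∀ᶠ a in U, ((f a).points ∩ Metric.ball m ε).Nonempty := by
  have := t2Space (M := M) hr
  constructor
  · intro h m
    rw [tendsto_nhds_unique h (tendsto_ultralimit hr U f)]
    rfl
  · intro h
    have : P = ultralimit U f := ext_points (Set.ext h)
    exact this ▸ tendsto_ultralimit hr U f

end VagueTopology

section Tuples

variable {M : Type*} [MetricSpace M] {r : ℝ} {ι : Type*} [Fintype ι]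

/-- The `ι`-tuples of points of `P`. With the supremum metric on `ι → M` they form a uniformly
discrete set of the same radius. -/
def tuples (ι : Type*) [Fintype ι] (hr : 0 < r) (P : PointSet M r) : PointSet (ι → M) r :=
  ⟨{p | ∀ i, p i ∈ P.points}, by
    rintro m a ⟨ha, ham⟩ b ⟨hb, hbm⟩
    rw [ball_pi _ hr, mem_univ_pi] at ham hbm
    exact funext fun i => P.eq_of_mem_ball (ha i) (hb i) (ham i) (hbm i)⟩

theorem mem_tuples {hr : 0 < r} {P : PointSet M r} {p : ι → M} :
    p ∈ (tuples ι hr P).points ↔ ∀ i, p i ∈ P.points := Iff.rfl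

/-- A ball of tuples is a product of balls, so it is eventually met if and only if each
factor is. -/
theorem continuous_tuples [ProperSpace M] (hr : 0 < r) :
    Continuous (tuples ι hr : PointSet M r → PointSet (ι → M) r) := by
  rw [continuous_iff_ultrafilter]
  intro P U hU
  rw [tendsto_ultrafilter_iff hr]
  have hU' := (tendsto_ultrafilter_iff (f := id) hr).1 hU
  intro m
  rw [mem_tuples]
  simp_rw [hU']
  have : ∀ (ε : ℝ), 0 < ε → ((∀ᶠ a in (U : Filter (PointSet M r)),
      ((tuples ι hr a).points ∩ Metric.ball m ε).Nonempty) ↔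
      ∀ i, ∀ᶠ a in (U : Filter (PointSet M r)), (a.points ∩ Metric.ball (m i) ε).Nonempty) := by
    intro ε hε
    rw [← eventually_all]
    refine eventually_congr (Eventually.of_forall fun a => ?_)
    rw [ball_pi _ hε]
    constructor
    · rintro ⟨p, hp, hpm⟩ i
      exact ⟨p i, hp i, hpm i (mem_univ i)⟩
    · intro h
      choose p hp using h
      exact ⟨p, fun i => (hp i).1, fun i _ => (hp i).2⟩
  constructor
  · intro h ε hε
    exact (this ε hε).2 fun i => h i ε hε
  · intro h i ε hε
    exact (this ε hε).1 (h ε hε) i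

end Tuples

section Smul

variable {T M : Type*} [Group T] [MetricSpace M] [MulAction T M] [IsIsometricSMul T M] {r : ℝ}

theorem smul_points_inter_ball (x : T) (P : PointSet M r) (m : M) (ε : ℝ) :
    ((x • P).points ∩ Metric.ball m ε).Nonempty ↔
      (P.points ∩ Metric.ball (x⁻¹ • m) ε).Nonempty := by
  rw [points_smul, ← smul_set_nonempty (a := x⁻¹), smul_set_inter, inv_smul_smul,
    Metric.smul_ball]

theorem continuousSMul [TopologicalSpace T] [IsTopologicalGroup T] [ContinuousSMul T M]
    [ProperSpace M] (hr : 0 < r) : ContinuousSMul T (PointSet M r) where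
  continuous_smul := by
    rw [continuous_iff_ultrafilter]
    rintro ⟨x, P⟩ U hU
    rw [tendsto_ultrafilter_iff hr]
    have hx : Tendsto Prod.fst (U : Filter (T × PointSet M r)) (𝓝 x) :=
      (continuous_fst.tendsto (x, P)).comp hU
    have hP : Tendsto Prod.snd (U : Filter (T × PointSet M r)) (𝓝 P) :=
      (continuous_snd.tendsto (x, P)).comp hU
    rw [tendsto_ultrafilter_iff hr] at hP
    intro m
    have hxm : Tendsto (fun a : T × PointSet M r => a.1⁻¹ • m) U (𝓝 (x⁻¹ • m)) :=
      hx.inv.smul tendsto_const_nhds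
    rw [points_smul, mem_smul_set_iff_inv_smul_mem, hP]
    simp_rw [smul_points_inter_ball]
    constructor
    · intro h ε hε
      filter_upwards [h (ε / 2) (half_pos hε), hxm (Metric.ball_mem_nhds _ (half_pos hε))]
        with a ⟨p, hp, hpm⟩ ha
      refine ⟨p, hp, ?_⟩
      simp only [Metric.mem_ball, mem_preimage] at *
      linarith [dist_triangle p (x⁻¹ • m) (a.1⁻¹ • m), dist_comm (x⁻¹ • m) (a.1⁻¹ • m)]
    · intro h ε hε
      filter_upwards [h (ε / 2) (half_pos hε), hxm (Metric.ball_mem_nhds _ (half_pos hε))]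
        with a ⟨p, hp, hpm⟩ ha
      refine ⟨p, hp, ?_⟩
      simp only [Metric.mem_ball, mem_preimage] at *
      linarith [dist_triangle p (a.1⁻¹ • m) (x⁻¹ • m)]

end Smul

end PointSet

/-! ### Proper isometric actions -/

section ProperAction

variable {T M : Type*} [Group T] [TopologicalSpace T]
  [MetricSpace M] [MulAction T M] [ProperSMul T M]

theorem isProperMap_smul_const (m : M) : IsProperMap fun x : T => x • m := by
  refine isProperMap_of_comp_of_t2 (g := fun y : M => (y, m)) (by fun_prop) (by fun_prop) ?_
  have hp : IsProperMap fun x : T => (x, m) := by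
    refine IsClosedEmbedding.isProperMap ⟨isEmbedding_prodMkLeft m, ?_⟩
    have : range (fun x : T => (x, m)) = univ ×ˢ {m} := by ext ⟨a, b⟩; simp [eq_comm]
    rw [this]
    exact isClosed_univ.prod isClosed_singleton
  exact ProperSMul.isProperMap_smul_pair.comp hp

theorem isCompact_setOf_smul_mem (m : M) {B : Set M} (hB : IsCompact B) :
    IsCompact {x : T | x • m ∈ B} :=
  (isProperMap_smul_const m).isCompact_preimage hB

/-- Orbits of nonempty tuples are closed, since the orbit map is proper already on one
coordinate. -/
theorem isClosed_range_smul_tuple {ι : Type*} [Nonempty ι] (e : ι → M) :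
    IsClosed (range fun x : T => x • e) := by
  obtain ⟨i⟩ := ‹Nonempty ι›
  refine IsProperMap.isClosed_range ?_
  refine isProperMap_of_comp_of_t2 (g := fun p : ι → M => p i)
    (continuous_pi fun j => ?_) (continuous_apply i) (isProperMap_smul_const (e i))
  exact (isProperMap_smul_const (e j)).continuous

theorem locallyCompactSpace_of_properSMul [IsTopologicalGroup T] [ProperSpace M] [Nonempty M] :
    LocallyCompactSpace T := by
  obtain ⟨m⟩ := ‹Nonempty M›
  refine IsCompact.locallyCompactSpace_of_mem_nhds_of_group
    (isCompact_setOf_smul_mem m (isCompact_closedBall m 1)) (x := 1) ?_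
  refine (isProperMap_smul_const m).continuous.continuousAt.preimage_mem_nhds ?_
  rw [one_smul]
  exact Metric.closedBall_mem_nhds m one_pos

theorem secondCountableTopology_of_properSMul [TopologicalSpace.MetrizableSpace T] [ProperSpace M]
    [Nonempty M] : SecondCountableTopology T := by
  obtain ⟨m⟩ := ‹Nonempty M›
  have : SigmaCompactSpace T := by
    refine SigmaCompactSpace.of_countable
      (range fun n : ℕ => {x : T | x • m ∈ Metric.closedBall m n}) (countable_range _) ?_ ?_
    · rintro _ ⟨n, rfl⟩
      exact isCompact_setOf_smul_mem m (isCompact_closedBall m _)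
    · rw [sUnion_range, eq_univ_iff_forall]
      intro x
      obtain ⟨n, hn⟩ := exists_nat_ge (dist (x • m) m)
      exact mem_iUnion.2 ⟨n, hn⟩
  let := TopologicalSpace.metrizableSpaceMetric T
  infer_instance

end ProperAction

/-! ### Van Hove sequences -/

section VanHove

variable {T : Type*} [Group T] [TopologicalSpace T]

theorem vanHoveBoundary_subset {K D : Set T} : vanHoveBoundary K D ⊆ K * D ∪ D := by
  rintro x (hx | hx)
  · exact Or.inl hx.1
  · exact Or.inr (not_not.1 hx.2)

/-- The points reached by `K` both from `D` and from its complement lie in the boundary. -/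
theorem mem_vanHoveBoundary {K D : Set T} {x : T} (h : x ∈ K * D) (h' : x ∈ K * Dᶜ) :
    x ∈ vanHoveBoundary K D := by
  by_cases hx : x ∈ D
  · exact Or.inr ⟨mul_subset_mul_left subset_closure h', fun h => h hx⟩
  · exact Or.inl ⟨h, fun h => hx (interior_subset h)⟩

variable [MeasurableSpace T] {vol : Measure T}

theorem measure_vanHoveBoundary_ne_top [ContinuousMul T] [IsFiniteMeasureOnCompacts vol]
    {K D : Set T} (hK : IsCompact K) (hD : IsCompact D) :
    vol (vanHoveBoundary K D) ≠ ⊤ :=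
  ((measure_mono vanHoveBoundary_subset).trans_lt ((hK.mul hD).union hD).measure_lt_top).ne

theorem IsVanHove.eventually_pos [IsFiniteMeasureOnCompacts vol] [vol.IsOpenPosMeasure]
    {D : ℕ → Set T} (hD : IsVanHove vol D) :
    ∀ᶠ n in atTop, 0 < vol.real (D n) := by
  obtain ⟨n, hn⟩ := mem_iUnion.1 (hD.iUnion_interior ▸ mem_univ (1 : T))
  filter_upwards [eventually_ge_atTop n] with k hk
  refine ENNReal.toReal_pos (ne_of_gt ?_) (hD.isCompact k).measure_lt_top.ne
  exact (isOpen_interior.measure_pos vol ⟨1, hn⟩).trans_le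
    (measure_mono (interior_subset.trans (hD.monotone hk)))

theorem IsVanHove.tendsto_measure_atTop [IsTopologicalGroup T] [BorelSpace T]
    [vol.IsHaarMeasure] [NoncompactSpace T]
    [LocallyCompactSpace T] {D : ℕ → Set T} (hD : IsVanHove vol D) :
    Tendsto (fun n => vol.real (D n)) atTop atTop := by
  have h := tendsto_measure_iUnion_atTop (μ := vol) hD.monotone
  have hu : ⋃ n, D n = univ := univ_subset_iff.1
    (hD.iUnion_interior.symm.subset.trans (iUnion_mono fun n => interior_subset))
  rw [hu, measure_univ_of_isMulLeftInvariant] at h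
  rw [tendsto_atTop]
  intro b
  filter_upwards [(tendsto_order.1 h).1 _ (ENNReal.ofReal_lt_top (r := b))] with n hn
  exact (ENNReal.ofReal_le_iff_le_toReal (hD.isCompact n).measure_lt_top.ne).1 hn.le

end VanHove

/-! ### Averages over van Hove sequences and unique ergodicity -/

section Ergodic

variable {T X : Type*} [Group T] [MulAction T X] [MeasurableSpace T]

/-- The average of `f` over the piece `{xP : x ∈ D}` of the orbit of `P`. -/
noncomputable def orbitAverage (vol : Measure T) (D : Set T) (f : X → ℝ) (P : X) : ℝ :=
  (∫ x in D, f (x • P) ∂vol) / vol.real D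

theorem abs_orbitAverage_le {vol : Measure T} {D : Set T} (hD : vol D < ⊤) {f : X → ℝ} {C : ℝ}
    (hC : 0 ≤ C) (hf : ∀ P, |f P| ≤ C) (P : X) : |orbitAverage vol D f P| ≤ C := by
  rw [orbitAverage, abs_div, abs_of_nonneg measureReal_nonneg]
  refine div_le_of_le_mul₀ measureReal_nonneg hC ?_
  exact norm_setIntegral_le_of_norm_le_const (f := fun x => f (x • P)) hD fun x _ => hf _

theorem orbitAverage_smul (vol : Measure T) (D : Set T) (c : ℝ) (f : X → ℝ) (P : X) :
    orbitAverage vol D (c • f) P = c * orbitAverage vol D f P := by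
  simp only [orbitAverage, Pi.smul_apply, smul_eq_mul]
  rw [integral_const_mul, mul_div_assoc]

variable [TopologicalSpace T] [BorelSpace T]
  [TopologicalSpace X] [ContinuousSMul T X] {vol : Measure T} [vol.IsHaarMeasure]

theorem continuous_orbitAverage {D : Set T} (hD : IsCompact D) [SecondCountableTopology T]
    [CompactSpace X] [TopologicalSpace.MetrizableSpace X] (f : C(X, ℝ)) :
    Continuous (orbitAverage vol D f : X → ℝ) := by
  refine Continuous.div_const ?_ _
  have : IsFiniteMeasure (vol.restrict D) := ⟨by simpa using hD.measure_lt_top⟩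
  refine continuous_of_dominated (bound := fun _ => ‖f‖) (fun P => ?_) (fun P => ?_)
    (integrable_const _) ?_
  · exact (by fun_prop : Continuous fun x : T => f (x • P)).aestronglyMeasurable
  · exact Eventually.of_forall fun x => f.norm_coe_le_norm _
  · exact Eventually.of_forall fun x => by fun_prop

/-- Fubini and invariance: averaging over the orbit does not change the space mean. -/
theorem integral_orbitAverage {D : Set T} (hD : IsCompact D) (hpos : 0 < vol.real D)
    [SecondCountableTopology T] [CompactSpace X] [TopologicalSpace.MetrizableSpace X]
    [MeasurableSpace X] [BorelSpace X] (μ : Measure X) [IsProbabilityMeasure μ]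
    [SMulInvariantMeasure T X μ] (f : C(X, ℝ)) :
    ∫ P, orbitAverage vol D f P ∂μ = ∫ P, f P ∂μ := by
  have : IsFiniteMeasure (vol.restrict D) := ⟨by simpa using hD.measure_lt_top⟩
  have : SecondCountableTopology X := by
    let := TopologicalSpace.metrizableSpaceMetric X
    infer_instance
  simp only [orbitAverage]
  rw [integral_div, integral_integral_swap]
  · have : ∀ x : T, ∫ P, f (x • P) ∂μ = ∫ P, f P ∂μ := fun x => integral_smul_eq_self f
    simp_rw [this]
    rw [setIntegral_const, smul_eq_mul, mul_div_cancel_left₀ _ hpos.ne']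
  · refine Integrable.of_bound (C := ‖f‖) ?_ (Eventually.of_forall fun x => f.norm_coe_le_norm _)
    exact (by fun_prop : Continuous fun q : X × T => f (q.2 • q.1)).aestronglyMeasurable

variable [T2Space T]

theorem integrableOn_orbit (f : C(X, ℝ)) (P : X) {D : Set T} (hD : IsCompact D) :
    IntegrableOn (fun x => f (x • P)) D vol :=
  (by fun_prop : Continuous fun x : T => f (x • P)).continuousOn.integrableOn_compact hD

theorem orbitAverage_add {D : Set T} (hD : IsCompact D) (f g : C(X, ℝ)) (P : X) :
    orbitAverage vol D (f + g : C(X, ℝ)) P = orbitAverage vol D f P + orbitAverage vol D g P := by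
  simp only [orbitAverage, ContinuousMap.add_apply]
  rw [integral_add (integrableOn_orbit f P hD) (integrableOn_orbit g P hD), add_div]

variable [IsTopologicalGroup T]

theorem abs_integral_translate_sub_le {D : Set T} (hD : IsCompact D) {g : T → ℝ}
    (hg : Continuous g) {C : ℝ} (hC : ∀ x, |g x| ≤ C) (y : T) :
    |∫ x in D, g (y * x) ∂vol - ∫ x in D, g x ∂vol| ≤
      2 * C * vol.real (vanHoveBoundary {y} D) := by
  have hyD : IsCompact (y • D) := hD.smul y
  have h1 : ∫ x in D, g (y * x) ∂vol = ∫ x in y • D, g x ∂vol := by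
    rw [← integral_indicator hD.measurableSet, ← integral_indicator hyD.measurableSet,
      ← integral_mul_left_eq_self ((y • D).indicator g) y]
    congr 1
    ext x
    by_cases hx : x ∈ D
    · have hx' : y * x ∈ y • D := smul_mem_smul_set (a := y) hx
      rw [indicator_of_mem hx, indicator_of_mem hx']
    · rw [indicator_of_notMem hx, indicator_of_notMem]
      rwa [← smul_eq_mul, smul_mem_smul_set_iff]
  have hi : ∀ {A : Set T}, IsCompact A → IntegrableOn g A vol :=
    fun hA => hg.continuousOn.integrableOn_compact hA
  have hfin : vol (vanHoveBoundary {y} D) ≠ ⊤ :=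
    measure_vanHoveBoundary_ne_top isCompact_singleton hD
  have hb : ∀ {A : Set T}, A ⊆ vanHoveBoundary {y} D →
      |∫ x in A, g x ∂vol| ≤ C * vol.real (vanHoveBoundary {y} D) := fun {A} hA => by
    have hC0 : 0 ≤ C := (abs_nonneg _).trans (hC 1)
    refine (norm_setIntegral_le_of_norm_le_const (f := g)
      ((measure_mono hA).trans_lt hfin.lt_top) fun x _ => hC x).trans ?_
    exact mul_le_mul_of_nonneg_left (measureReal_mono hA hfin) hC0
  have e1 := integral_inter_add_sdiff (μ := vol) hD.measurableSet (hi hyD)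
  have e2 := integral_inter_add_sdiff (μ := vol) hyD.measurableSet (hi hD)
  rw [inter_comm] at e2
  have b1 := hb (A := y • D \ D) fun x hx => Or.inl
    ⟨by rw [singleton_mul]; exact hx.1, fun h => hx.2 (interior_subset h)⟩
  have b2 := hb (A := D \ y • D) fun x hx => Or.inr
    ⟨by
      rw [singleton_mul]
      refine ⟨y⁻¹ * x, subset_closure fun h => hx.2 ⟨_, h, by simp⟩, by simp⟩,
      fun h => h hx.1⟩
  rw [h1, ← e1, ← e2]
  rw [abs_le] at *
  constructor <;> linarith

/-- Averages along a van Hove sequence are asymptotically invariant. -/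
theorem IsVanHove.tendsto_orbitAverage_smul_sub {D : ℕ → Set T} (hD : IsVanHove vol D)
    [CompactSpace X] (f : C(X, ℝ)) (y : T) (P : ℕ → X) :
    Tendsto (fun n : ℕ => orbitAverage vol (D n) (fun R => f (y • R)) (P n) -
      orbitAverage vol (D n) f (P n)) atTop (𝓝 0) := by
  have h := (hD.tendsto_boundary {y} isCompact_singleton).const_mul (2 * ‖f‖)
  rw [mul_zero] at h
  refine squeeze_zero_norm (fun n : ℕ => ?_) h
  rw [orbitAverage, orbitAverage, ← sub_div, norm_div, Real.norm_eq_abs, Real.norm_eq_abs,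
    abs_of_nonneg (measureReal_nonneg (s := D n)), ← mul_div_assoc]
  refine div_le_div_of_nonneg_right ?_ measureReal_nonneg
  simp_rw [← mul_smul]
  exact abs_integral_translate_sub_le (hD.isCompact n) (g := fun x => f (x • P n))
    (by fun_prop) (fun x => f.norm_coe_le_norm _) y

variable [CompactSpace X] [TopologicalSpace.MetrizableSpace X] [MeasurableSpace X] [BorelSpace X]

/-- Krylov–Bogoliubov: the limits of orbit averages along an ultrafilter are the integrals of an
invariant probability measure, by the Riesz–Markov–Kakutani theorem. -/
theorem IsVanHove.exists_invariant_measure {D : ℕ → Set T} (hD : IsVanHove vol D)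
    (U : Ultrafilter ℕ) (hU : (U : Filter ℕ) ≤ atTop) (P : ℕ → X) :
    ∃ μ : Measure X, (IsProbabilityMeasure μ ∧ SMulInvariantMeasure T X μ) ∧
      ∀ f : C(X, ℝ), Tendsto (fun n => orbitAverage vol (D n) f (P n)) U (𝓝 (∫ R, f R ∂μ)) := by
  have hlim : ∀ f : C(X, ℝ), ∃ l : ℝ,
      Tendsto (fun n => orbitAverage vol (D n) f (P n)) U (𝓝 l) := fun f => by
    obtain ⟨l, -, hl⟩ := isCompact_iff_ultrafilter_le_nhds.1
      (isCompact_Icc (a := -‖f‖) (b := ‖f‖)) (U.map fun n => orbitAverage vol (D n) f (P n)) (by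
        rw [le_principal_iff]
        refine Eventually.of_forall (f := (U : Filter ℕ)) fun n => abs_le.1 ?_
        exact abs_orbitAverage_le (hD.isCompact n).measure_lt_top (norm_nonneg f)
          f.norm_coe_le_norm _)
    exact ⟨l, hl⟩
  choose Λ hΛ using hlim
  let Λ' : C_c(X, ℝ) →ₗ[ℝ] ℝ :=
    { toFun := fun f => Λ f.toContinuousMap
      map_add' := fun f g => tendsto_nhds_unique (hΛ _)
        (((hΛ f.toContinuousMap).add (hΛ g.toContinuousMap)).congr fun n =>
          (orbitAverage_add (hD.isCompact n) _ _ _).symm)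
      map_smul' := fun c f => tendsto_nhds_unique (hΛ _)
        (((hΛ f.toContinuousMap).const_mul c).congr fun n =>
          (orbitAverage_smul _ _ _ _ _).symm) }
  have hΛ'0 : ∀ f, 0 ≤ f → 0 ≤ Λ' f := fun f hf => ge_of_tendsto (hΛ _) (Eventually.of_forall
    fun n => div_nonneg (integral_nonneg fun x => hf _) measureReal_nonneg)
  set μ := RealRMK.rieszMeasure (PositiveLinearMap.mk₀ Λ' hΛ'0) with hμ
  have hint : ∀ f : C(X, ℝ), ∫ R, f R ∂μ = Λ f := fun f =>
    RealRMK.integral_rieszMeasure (PositiveLinearMap.mk₀ Λ' hΛ'0)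
      ⟨f, HasCompactSupport.of_compactSpace f⟩
  have hprob : IsProbabilityMeasure μ := by
    have h1 : Λ 1 = 1 := by
      refine tendsto_nhds_unique (hΛ 1) (tendsto_const_nhds.congr' ?_)
      filter_upwards [hU hD.eventually_pos] with n hn
      simp only [orbitAverage, ContinuousMap.one_apply, setIntegral_const, smul_eq_mul, mul_one]
      rw [div_self hn.ne']
    have h2 := hint 1
    simp only [ContinuousMap.one_apply, integral_const, smul_eq_mul, mul_one, h1] at h2
    exact ⟨(ENNReal.toReal_eq_one_iff _).1 h2⟩
  refine ⟨μ, ⟨hprob, ⟨fun y s hs => ?_⟩⟩, fun f => by rw [hint]; exact hΛ f⟩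
  have hy : Measurable fun R : X => y • R := (continuous_const_smul y).measurable
  have : IsProbabilityMeasure (μ.map fun R => y • R) :=
    Measure.isProbabilityMeasure_map hy.aemeasurable
  rw [← Measure.map_apply hy hs]
  congr 1
  refine ext_of_forall_integral_eq_of_IsFiniteMeasure fun f => ?_
  rw [integral_map hy.aemeasurable f.continuous.aestronglyMeasurable]
  let g : C(X, ℝ) := f.toContinuousMap.comp ⟨fun R => y • R, continuous_const_smul y⟩
  have := hint g
  change ∫ R, g R ∂μ = ∫ R, f.toContinuousMap R ∂μ
  rw [hint, hint]
  have h := ((hD.tendsto_orbitAverage_smul_sub f.toContinuousMap y P).mono_left hU).add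
    (hΛ f.toContinuousMap)
  rw [zero_add] at h
  exact tendsto_nhds_unique (hΛ g) (h.congr fun n => sub_add_cancel _ _)

/-- Averages that stay away from the integral along some sequence of points would produce a second
invariant measure. -/
theorem UniquelyErgodic.tendstoUniformly_orbitAverage (hX : UniquelyErgodic T X)
    {D : ℕ → Set T} (hD : IsVanHove vol D) (f : C(X, ℝ)) :
    ∃ c : ℝ, TendstoUniformly (fun n => orbitAverage vol (D n) f) (fun _ => c) atTop := by
  obtain ⟨μ, ⟨hμ, -⟩, huniq⟩ := hX
  have : Nonempty X := μ.nonempty_of_neZero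
  refine ⟨∫ R, f R ∂μ, Metric.tendstoUniformly_iff.2 fun ε hε => ?_⟩
  by_contra hcon
  let bad : ℕ → X → Prop := fun n P => ε ≤ dist (∫ R, f R ∂μ) (orbitAverage vol (D n) f P)
  let P : ℕ → X := fun n => Classical.epsilon (bad n)
  have hfreq : ∃ᶠ n in atTop, bad n (P n) := by
    refine (not_eventually.1 hcon).mono fun n hn => ?_
    push Not at hn
    exact Classical.epsilon_spec hn
  have := frequently_iff_neBot.1 hfreq
  let U := Ultrafilter.of (atTop ⊓ 𝓟 {n | bad n (P n)})
  have hU := Ultrafilter.of_le (atTop ⊓ 𝓟 {n | bad n (P n)})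
  obtain ⟨μ', hμ', hlim⟩ := hD.exists_invariant_measure U (hU.trans inf_le_left) P
  have hlimf := hlim f
  rw [huniq μ' hμ'] at hlimf
  have h0 := (tendsto_const_nhds (x := ∫ R, f R ∂μ)).dist hlimf
  rw [dist_self] at h0
  exact hε.not_ge (ge_of_tendsto h0 (hU.trans inf_le_right (mem_principal_self _)))

/-- If the orbit averages of all functions in a separating subalgebra converge, uniformly on a
dense set, to constants, then the system is uniquely ergodic. -/
theorem IsVanHove.uniquelyErgodic_of_tendstoUniformlyOn [SecondCountableTopology T] [Nonempty X]
    {D : ℕ → Set T} (hD : IsVanHove vol D) (A : Subalgebra ℝ C(X, ℝ)) (hA : A.SeparatesPoints)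
    {Y : Set X} (hY : Dense Y) (h : ∀ f ∈ A, ∃ c : ℝ,
      TendstoUniformlyOn (fun n => orbitAverage vol (D n) f) (fun _ => c) atTop Y) :
    UniquelyErgodic T X := by
  obtain ⟨P₀⟩ := ‹Nonempty X›
  obtain ⟨μ, hμ, -⟩ := hD.exists_invariant_measure (Ultrafilter.of atTop) (Ultrafilter.of_le _)
    fun _ => P₀
  have hint : ∀ f ∈ A, ∃ c : ℝ, ∀ ν : Measure X,
      IsProbabilityMeasure ν ∧ SMulInvariantMeasure T X ν → ∫ P, f P ∂ν = c := by
    intro f hf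
    obtain ⟨c, hc⟩ := h f hf
    refine ⟨c, fun ν ⟨hν, hν'⟩ => ?_⟩
    have hlim : Tendsto (fun n => ∫ P, orbitAverage vol (D n) f P ∂ν) atTop (𝓝 (∫ _, c ∂ν)) := by
      refine tendsto_integral_of_dominated_convergence (fun _ => ‖f‖)
        (fun n => (continuous_orbitAverage (hD.isCompact n) f).aestronglyMeasurable)
        (integrable_const _) (fun n => Eventually.of_forall fun P =>
          abs_orbitAverage_le (hD.isCompact n).measure_lt_top (norm_nonneg f)
            f.norm_coe_le_norm P) (Eventually.of_forall fun P => ?_)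
      rw [Metric.tendsto_nhds]
      intro ε hε
      filter_upwards [Metric.tendstoUniformlyOn_iff.1 hc (ε / 2) (half_pos hε)] with n hn
      have hcl : IsClosed {P | dist c (orbitAverage vol (D n) f P) ≤ ε / 2} :=
        isClosed_le (continuous_const.dist (continuous_orbitAverage (hD.isCompact n) f))
          continuous_const
      have := hcl.closure_subset_iff.2 (fun P hP => (hn P hP).le) (hY P)
      rw [dist_comm]
      exact lt_of_le_of_lt this (half_lt_self hε)
    rw [integral_const, probReal_univ, one_smul] at hlim
    refine tendsto_nhds_unique (tendsto_const_nhds.congr' ?_) hlim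
    filter_upwards [hD.eventually_pos] with n hn
    exact (integral_orbitAverage (hD.isCompact n) hn ν f).symm
  refine ⟨μ, hμ, fun ν hν => ?_⟩
  have := hμ.1
  have := hν.1
  refine ext_of_forall_integral_eq_of_IsFiniteMeasure fun F => ?_
  let f : C(X, ℝ) := F.toContinuousMap
  change ∫ P, f P ∂ν = ∫ P, f P ∂μ
  refine eq_of_forall_dist_le fun ε hε => ?_
  have hf : f ∈ A.topologicalClosure := by
    rw [ContinuousMap.subalgebra_topologicalClosure_eq_top_of_separatesPoints A hA]
    trivial
  obtain ⟨g, hg, hfg⟩ := Metric.mem_closure_iff.1 hf (ε / 2) (half_pos hε)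
  obtain ⟨c, hc⟩ := hint g hg
  have key : ∀ ν : Measure X, IsProbabilityMeasure ν ∧ SMulInvariantMeasure T X ν →
      dist (∫ P, f P ∂ν) c ≤ ε / 2 := fun ν hν => by
    have := hν.1
    have hi : ∀ g : C(X, ℝ), Integrable g ν := fun g =>
      Integrable.of_bound g.continuous.aestronglyMeasurable ‖g‖
        (Eventually.of_forall g.norm_coe_le_norm)
    rw [← hc ν hν, Real.dist_eq, ← integral_sub (hi f) (hi g)]
    refine (norm_integral_le_of_norm_le_const (μ := ν) (f := fun P => f P - g P) (C := ε / 2)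
      (Eventually.of_forall fun P => ?_)).trans ?_
    · exact (ContinuousMap.dist_apply_le_dist P).trans hfg.le
    · simp
  linarith [dist_triangle_right (∫ P, f P ∂ν) (∫ P, f P ∂μ) c, key ν hν, key μ hμ]

end Ergodic

/-! ### Sums over tuples as sums over finite subsets -/

namespace PointSet

section FiberSum

variable {M ι : Type*}

theorem finite_setOf_range_eq [Finite ι] {Q : Set M} (hQ : Q.Finite) :
    {p : ι → M | range p = Q}.Finite :=
  (Set.Finite.pi' fun _ => hQ).subset fun p (hp : range p = Q) i => hp ▸ mem_range_self i

theorem range_smul_tuple {T : Type*} [SMul T M] (x : T) (p : ι → M) :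
    range (x • p) = x • range p := by
  rw [← image_smul, ← range_comp]
  rfl

variable [MetricSpace M]

/-- The sum of `h` over all tuples that enumerate the set `Q`, possibly with repetitions. -/
noncomputable def fiberSum (h : C_c(ι → M, ℝ)) (Q : Set M) : ℝ :=
  ∑ᶠ p ∈ {p : ι → M | range p = Q}, h p

theorem exists_of_fiberSum_ne_zero {h : C_c(ι → M, ℝ)} {Q : Set M} (hQ : fiberSum h Q ≠ 0) :
    ∃ p : ι → M, range p = Q ∧ h p ≠ 0 := by
  obtain ⟨p, hp, hne⟩ := exists_ne_zero_of_finsum_mem_ne_zero hQ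
  exact ⟨p, hp, hne⟩

variable [Fintype ι] {r : ℝ}

theorem fiberSum_eq_sum (h : C_c(ι → M, ℝ)) {Q : Set M} (hQ : Q.Finite) :
    fiberSum h Q = ∑ p ∈ (finite_setOf_range_eq (ι := ι) hQ).toFinset, h p :=
  finsum_mem_eq_finite_toFinset_sum _ _

theorem fiberSum_smul {T : Type*} [Group T] [MulAction T M] (h : C_c(ι → M, ℝ)) {Q : Set M}
    (hQ : Q.Finite) (x : T) :
    fiberSum h (x • Q) = ∑ p ∈ (finite_setOf_range_eq (ι := ι) hQ).toFinset, h (x • p) := by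
  rw [← finsum_mem_eq_finite_toFinset_sum (fun p => h (x • p)),
    ← finsum_mem_image (MulAction.injective x).injOn]
  have : {p : ι → M | range p = x • Q} = (x • ·) '' {p : ι → M | range p = Q} := by
    ext p
    rw [image_smul, mem_smul_set_iff_inv_smul_mem, mem_ofPred_eq, mem_ofPred_eq, range_smul_tuple,
      inv_smul_eq_iff]
  rw [fiberSum, this]

theorem continuous_fiberSum_smul {T : Type*} [Group T] [MulAction T M] [TopologicalSpace T]
    [ContinuousSMul T M] (h : C_c(ι → M, ℝ)) {Q : Set M} (hQ : Q.Finite) :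
    Continuous fun x : T => fiberSum h (x • Q) := by
  simp_rw [fiberSum_smul h hQ]
  exact continuous_finsetSum _ fun p _ => h.continuous.comp
    (continuous_id.smul continuous_const)

/-- A sum over the tuples of `P` regrouped according to their ranges. -/
theorem eval_tuples_eq_sum_fiberSum (hr : 0 < r) (h : C_c(ι → M, ℝ)) (P : PointSet M r)
    (E : Finset (Set M)) (hE : ∀ R ∈ E, R.Finite ∧ R ⊆ P.points)
    (hh : ∀ p ∈ (tuples ι hr P).points, h p ≠ 0 → range p ∈ E) :
    eval h (tuples ι hr P) = ∑ R ∈ E, fiberSum h R := by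
  classical
  have hfin : {p : ι → M | range p ∈ E}.Finite := by
    have : {p : ι → M | range p ∈ E} = ⋃ R ∈ E, {p : ι → M | range p = R} := by ext; simp
    rw [this]
    exact E.finite_toSet.biUnion fun R hR => finite_setOf_range_eq (hE R hR).1
  have hmem : ∀ p, p ∈ hfin.toFinset ↔ range p ∈ E := fun p => Set.Finite.mem_toFinset _
  rw [eval_eq_sum (P := tuples ι hr P) hfin.toFinset
    (fun p hp i => (hE _ ((hmem p).1 hp)).2 (mem_range_self i))
    fun p hp hne => (hmem p).2 (hh p hp hne),
    ← Finset.sum_fiberwise_of_maps_to fun p hp => (hmem p).1 hp]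
  refine Finset.sum_congr rfl fun R hR => ?_
  rw [fiberSum_eq_sum h (hE R hR).1]
  refine Finset.sum_congr ?_ fun _ _ => rfl
  ext p
  rw [Finset.mem_filter, hmem, Set.Finite.mem_toFinset, mem_ofPred_eq]
  exact ⟨fun h => h.2, fun h => ⟨h ▸ hR, h⟩⟩

end FiberSum

end PointSet

/-! ### Counting copies of a pattern by integrals -/

/-- Sets inside `W` that cover each point at most `N` times have total measure at most `N * μ W`. -/
theorem sum_measure_le_of_card_le {α κ : Type*} [MeasurableSpace α] (μ : Measure α)
    (s : Finset κ) {A : κ → Set α} (hA : ∀ i ∈ s, MeasurableSet (A i)) {W : Set α}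
    (hW : ∀ i ∈ s, A i ⊆ W) {N : ℕ} [∀ x, DecidablePred fun i => x ∈ A i]
    (hN : ∀ x, (s.filter fun i => x ∈ A i).card ≤ N) :
    ∑ i ∈ s, μ (A i) ≤ N * μ W := by
  have hUm : MeasurableSet (⋃ i ∈ s, A i) := s.measurableSet_biUnion hA
  calc ∑ i ∈ s, μ (A i) = ∑ i ∈ s, ∫⁻ x, (A i).indicator 1 x ∂μ :=
        Finset.sum_congr rfl fun i hi => (lintegral_indicator_one (hA i hi)).symm
    _ = ∫⁻ x, ∑ i ∈ s, (A i).indicator 1 x ∂μ :=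
        (lintegral_finsetSum' _ fun i hi => (measurable_one.indicator (hA i hi)).aemeasurable).symm
    _ ≤ ∫⁻ x, (⋃ i ∈ s, A i).indicator (fun _ => (N : ENNReal)) x ∂μ := by
        refine lintegral_mono fun x => ?_
        by_cases hx : x ∈ ⋃ i ∈ s, A i
        · rw [indicator_of_mem hx]
          simp only [indicator_apply, Pi.one_apply, Finset.sum_boole]
          exact_mod_cast hN x
        · rw [indicator_of_notMem hx, nonpos_iff_eq_zero]
          refine Finset.sum_eq_zero fun i hi => indicator_of_notMem (fun h => hx ?_) _
          exact mem_biUnion hi h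
    _ = N * μ (⋃ i ∈ s, A i) := lintegral_indicator_const hUm _
    _ ≤ N * μ W := by
        gcongr
        exact iUnion₂_subset hW

section Copies

variable {M : Type*} [MetricSpace M] {T : Type*} [Group T] [MulAction T M] {r : ℝ}

/-- The subsets `R` of `P` that some element of `D` carries to `Q`. -/
def copies (D : Set T) (Q : Set M) (P : Set M) : Set (Set M) :=
  {R : Set M | R ⊆ P ∧ ∃ x ∈ D, x • R = Q}

/-- Replacing each copy `R` of `Q` in `P` by `yR` moves the base point `y` into the point set. -/
theorem patternFreq_eq [IsIsometricSMul T M] [MeasurableSpace T] (vol : Measure T)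
    (D : Set T) (Q : Set M) (y : T) (P : PointSet M r) :
    patternFreq vol D Q y P = ((copies D Q (y • P).points).ncard : ℝ) / vol.real D := by
  rw [patternFreq]
  congr 2
  rw [← Set.ncard_image_of_injective _ (MulAction.injective (β := Set M) y)]
  congr 1
  ext R
  constructor
  · rintro ⟨R, ⟨hR, x, ⟨d, hd, z, hz, rfl⟩, hx⟩, rfl⟩
    rw [mem_singleton_iff.1 hz] at hx
    exact ⟨smul_set_mono hR, d, hd, by rw [← hx]; exact (mul_smul d y R).symm⟩
  · rintro ⟨hR, d, hd, hx⟩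
    refine ⟨y⁻¹ • R, ⟨?_, d * y, mul_mem_mul hd rfl, ?_⟩, smul_inv_smul y R⟩
    · rwa [← subset_smul_set_iff]
    · rw [mul_smul, smul_inv_smul, hx]

end Copies

section Counting

variable {M : Type*} [MetricSpace M] {T : Type*} [Group T] [TopologicalSpace T]
  [IsTopologicalGroup T] [T2Space T] [LocallyCompactSpace T]
  [MulAction T M] [ProperSMul T M] [IsIsometricSMul T M]
  [MeasurableSpace T] [BorelSpace T] {r : ℝ}

/-- Every copy `R = g⁻¹Q` with `Lg ⊆ D` contributes the same constant to the integral as to the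
count, every copy with `Lg ∩ D = ∅` contributes to neither; the sets `Ug`, for the remaining copies,
lie in a van Hove boundary of `D` and overlap with bounded multiplicity. -/
theorem exists_abs_sum_integral_sub_ncard_copies_le (vol : Measure T) [vol.IsHaarMeasure]
    [vol.IsMulRightInvariant] (hr : 0 < r) {Q : Set M} (hQ : Q.Finite) (hQne : Q.Nonempty)
    {H : Set M → ℝ} (hH : Continuous fun x : T => H (x • Q)) {B : Set M} (hB : IsCompact B)
    (hQB : Q ⊆ B) (hHB : ∀ R, H R ≠ 0 → R ⊆ B) :
    ∃ K : Set T, IsCompact K ∧ ∃ C : ℝ, ∀ (P : PointSet M r) (D : Set T), IsCompact D →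
      ∀ E : Finset (Set M), (∀ R ∈ E, R ⊆ P.points ∧ R ∈ MulAction.orbit T Q) →
        copies D Q P.points ⊆ E →
        |∑ R ∈ E, ∫ x in D, H (x • R) ∂vol -
          (∫ x, H (x • Q) ∂vol) * (copies D Q P.points).ncard| ≤
            C * vol.real (vanHoveBoundary K D) := by
  classical
  obtain ⟨q₀, hq₀⟩ := hQne
  set L : Set T := {x | x • q₀ ∈ B} with hL
  have hLc : IsCompact L := isCompact_setOf_smul_mem q₀ hB
  have hHL : ∀ x : T, H (x • Q) ≠ 0 → x ∈ L := fun x hx => hHB _ hx (smul_mem_smul_set hq₀)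
  have hSL : ∀ x : T, x • Q = Q → x ∈ L := fun x hx => hQB (hx ▸ smul_mem_smul_set hq₀)
  obtain ⟨U, hUc, hU1⟩ := exists_compact_mem_nhds (1 : T)
  have hvU : 0 < vol.real U :=
    ENNReal.toReal_pos (Measure.measure_pos_of_mem_nhds vol hU1).ne' hUc.measure_lt_top.ne
  obtain ⟨N, hN⟩ := PointSet.exists_ncard_inter_le (r := r) hr (hUc.smul_set hQ.isCompact)
  set c := ∫ x, H (x • Q) ∂vol with hc
  set I := ∫ x, |H (x • Q)| ∂vol with hI
  have hHint : Integrable (fun x : T => H (x • Q)) vol :=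
    hH.integrable_of_hasCompactSupport (HasCompactSupport.intro hLc fun x hx => by
      by_contra h
      exact hx (hHL x h))
  have hK : IsCompact (U * L⁻¹) := hUc.mul hLc.inv
  refine ⟨U * L⁻¹, hK, (|c| + I) * (2 ^ N / vol.real U), fun P D hD E hE hEc => ?_⟩
  have hg : ∀ R ∈ E, ∃ g : T, g • R = Q := fun R hR => by
    obtain ⟨x, hx⟩ := (hE R hR).2
    exact ⟨x⁻¹, by rw [← hx]; exact inv_smul_smul x Q⟩
  choose! g hg using hg
  have hgR : ∀ R ∈ E, ∀ x : T, x • R = (x * (g R)⁻¹) • Q := fun R hR x => by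
    rw [mul_smul, ← hg R hR, inv_smul_smul]
  -- the copies whose contributions to the integral and to the count may differ
  let 𝓑 : Finset (Set M) := E.filter fun R => (∃ l ∈ L, l * g R ∈ D) ∧ ∃ l ∈ L, l * g R ∉ D
  have hbound : (𝓑.card : ℝ) ≤ 2 ^ N / vol.real U * vol.real (vanHoveBoundary (U * L⁻¹) D) := by
    have h1 : ∑ R ∈ 𝓑, vol ((fun x => x * (g R)⁻¹) ⁻¹' U) ≤
        (2 ^ N : ℕ) * vol (vanHoveBoundary (U * L⁻¹) D) := by
      refine sum_measure_le_of_card_le vol 𝓑 (fun R _ => ?_) (fun R hR x hx => ?_) fun x => ?_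
      · exact measurable_mul_const _ hUc.measurableSet
      · obtain ⟨-, ⟨l, hl, hlD⟩, l', hl', hlD'⟩ := Finset.mem_filter.1 hR
        have key : ∀ k ∈ L, ∀ A : Set T, k * g R ∈ A → x ∈ U * L⁻¹ * A := fun k hk A hA =>
          ⟨x * (g R)⁻¹ * k⁻¹, mul_mem_mul hx (inv_mem_inv.2 hk), k * g R, hA, by group⟩
        exact mem_vanHoveBoundary (key l hl D hlD) (key l' hl' Dᶜ hlD')
      · -- if `x ∈ U * g R`, then `x • R` consists of points of `x • P` in `U • Q`
        obtain ⟨hfin, hcard⟩ := hN (x • P)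
        refine le_trans (Finset.card_le_card_of_injOn (t := hfin.toFinset.powerset)
          (fun R => hfin.toFinset.filter (· ∈ x • R)) (fun R _ => ?_) fun R hR R' hR' h => ?_) ?_
        · exact Finset.mem_coe.2 (Finset.mem_powerset.2 (Finset.filter_subset _ _))
        · have key : ∀ R ∈ ((𝓑.filter fun R => x ∈ (fun x => x * (g R)⁻¹) ⁻¹' U) :
              Finset (Set M)), ∀ m ∈ x • R, m ∈ hfin.toFinset := by
            intro R hR m hm
            obtain ⟨hRB, hx⟩ := Finset.mem_filter.1 hR
            have hRE := (Finset.mem_filter.1 hRB).1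
            rw [Set.Finite.mem_toFinset]
            refine ⟨smul_set_mono (hE R hRE).1 hm, ?_⟩
            rw [hgR R hRE] at hm
            obtain ⟨q, hq, rfl⟩ := hm
            exact smul_mem_smul hx hq
          refine MulAction.injective x (Set.ext fun m => ?_)
          have h := Finset.ext_iff.1 h m
          simp only [Finset.mem_filter] at h
          exact ⟨fun hm => (h.1 ⟨key R hR m hm, hm⟩).2, fun hm => (h.2 ⟨key R' hR' m hm, hm⟩).2⟩
        · rw [Finset.card_powerset, ← Set.ncard_eq_toFinset_card _ hfin]
          exact Nat.pow_le_pow_right two_pos hcard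
    simp_rw [measure_preimage_mul_right, Finset.sum_const, nsmul_eq_mul] at h1
    have hfin : vol (vanHoveBoundary (U * L⁻¹) D) ≠ ⊤ := measure_vanHoveBoundary_ne_top hK hD
    have h2 := ENNReal.toReal_mono (ENNReal.mul_ne_top (ENNReal.natCast_ne_top _) hfin) h1
    rw [ENNReal.toReal_mul, ENNReal.toReal_mul, ENNReal.toReal_natCast, ENNReal.toReal_natCast]
      at h2
    rw [div_mul_eq_mul_div, le_div_iff₀ hvU]
    exact_mod_cast h2
  have hterm : ∀ R ∈ E, |∫ x in D, H (x • R) ∂vol - c * (if ∃ x ∈ D, x • R = Q then 1 else 0)| ≤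
      if R ∈ 𝓑 then |c| + I else 0 := by
    intro R hR
    have hcint : ∫ x, H (x • R) ∂vol = c := by
      simp_rw [hgR R hR]
      exact integral_mul_right_eq_self (fun x => H (x • Q)) _
    have hiR : Integrable (fun x : T => H (x • R)) vol := by
      simp_rw [hgR R hR]
      exact hHint.comp_mul_right _
    have hIR : ∫ x, |H (x • R)| ∂vol = I := by
      simp_rw [hgR R hR]
      exact integral_mul_right_eq_self (fun x => |H (x • Q)|) _
    have hsupp : ∀ x : T, H (x • R) ≠ 0 → ∃ l ∈ L, l * g R = x := fun x hx => by
      rw [hgR R hR] at hx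
      exact ⟨_, hHL _ hx, by group⟩
    have hcopy : ∀ x : T, x • R = Q → ∃ l ∈ L, l * g R = x := fun x hx => by
      rw [hgR R hR] at hx
      exact ⟨_, hSL _ hx, by group⟩
    -- both the integrand and the property of being carried to `Q` live on `L * g R`
    by_cases h1 : ∃ l ∈ L, l * g R ∈ D
    · by_cases h2 : ∃ l ∈ L, l * g R ∉ D
      · rw [if_pos (Finset.mem_filter.2 ⟨hR, h1, h2⟩)]
        have a1 : |∫ x in D, H (x • R) ∂vol| ≤ I := by
          rw [← hIR]
          refine abs_integral_le_integral_abs.trans ?_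
          exact setIntegral_le_integral hiR.abs (Eventually.of_forall fun x => abs_nonneg _)
        have a2 : |c * (if ∃ x ∈ D, x • R = Q then (1 : ℝ) else 0)| ≤ |c| := by
          split_ifs <;> simp
        linarith [abs_sub (∫ x in D, H (x • R) ∂vol)
          (c * (if ∃ x ∈ D, x • R = Q then (1 : ℝ) else 0))]
      · push Not at h2
        have hR𝓑 : R ∉ 𝓑 := fun h => by
          obtain ⟨-, -, l, hl, hlD⟩ := Finset.mem_filter.1 h
          exact hlD (h2 l hl)
        rw [if_neg hR𝓑, if_pos ⟨g R, by simpa using h2 1 (hSL 1 (one_smul T Q)), hg R hR⟩,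
          setIntegral_eq_integral_of_forall_compl_eq_zero, hcint]
        · simp
        · intro x hx
          by_contra hne
          obtain ⟨l, hl, rfl⟩ := hsupp x hne
          exact hx (h2 l hl)
    · have hR𝓑 : R ∉ 𝓑 := fun h => h1 (Finset.mem_filter.1 h).2.1
      rw [if_neg hR𝓑, if_neg, setIntegral_eq_zero_of_forall_eq_zero]
      · simp
      · intro x hx
        by_contra hne
        obtain ⟨l, hl, rfl⟩ := hsupp x hne
        exact h1 ⟨l, hl, hx⟩
      · rintro ⟨x, hx, hxR⟩
        obtain ⟨l, hl, rfl⟩ := hcopy x hxR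
        exact h1 ⟨l, hl, hx⟩
  have hcount : ((copies D Q P.points).ncard : ℝ) =
      ∑ R ∈ E, if ∃ x ∈ D, x • R = Q then (1 : ℝ) else 0 := by
    have : copies D Q P.points = (E.filter fun R => ∃ x ∈ D, x • R = Q : Finset (Set M)) := by
      ext R
      rw [Finset.mem_coe, Finset.mem_filter]
      exact ⟨fun h => ⟨hEc h, h.2⟩, fun h => ⟨(hE R h.1).1, h.2⟩⟩
    rw [this, Set.ncard_coe_finset, Finset.sum_boole]
  have hI0 : 0 ≤ |c| + I := add_nonneg (abs_nonneg _) (integral_nonneg fun _ => abs_nonneg _)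
  rw [hcount, Finset.mul_sum, ← Finset.sum_sub_distrib]
  refine (Finset.abs_sum_le_sum_abs _ _).trans ((Finset.sum_le_sum hterm).trans ?_)
  rw [Finset.sum_ite_mem, Finset.inter_eq_right.2 (Finset.filter_subset _ _), Finset.sum_const,
    nsmul_eq_mul, mul_comm, mul_assoc]
  exact mul_le_mul_of_nonneg_left hbound hI0

variable {ι : Type*} [Fintype ι]

/-- The integral of a sum over tuples, compared with the number of copies of the representatives
`𝒬` of the orbits that contribute to it. -/
theorem exists_abs_integral_sub_sum_le (vol : Measure T) [vol.IsHaarMeasure]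
    [vol.IsMulRightInvariant] (hr : 0 < r) (h : C_c(ι → M, ℝ)) (𝒬 : Finset (Set M))
    (h𝒬 : ∀ Q ∈ 𝒬, Q.Finite ∧ Q.Nonempty)
    (hinj : ∀ Q ∈ 𝒬, ∀ Q' ∈ 𝒬, Q' ∈ MulAction.orbit T Q → Q' = Q) :
    ∃ K : Set M → Set T, (∀ Q ∈ 𝒬, IsCompact (K Q)) ∧ ∃ C : Set M → ℝ, ∀ P : PointSet M r,
      (∀ x : T, ∀ p ∈ (PointSet.tuples ι hr (x • P)).points, h p ≠ 0 →
        ∃ Q ∈ 𝒬, range p ∈ MulAction.orbit T Q) → ∀ D : Set T, IsCompact D →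
      |∫ x in D, PointSet.eval h (PointSet.tuples ι hr (x • P)) ∂vol -
        ∑ Q ∈ 𝒬, (∫ x : T, PointSet.fiberSum h (x • Q) ∂vol) * (copies D Q P.points).ncard| ≤
          ∑ Q ∈ 𝒬, C Q * vol.real (vanHoveBoundary (K Q) D) := by
  classical
  set B : Set M := (⋃ i, (fun p : ι → M => p i) '' tsupport h) ∪ ⋃ Q ∈ 𝒬, Q with hBdef
  have hB : IsCompact B := by
    refine (isCompact_iUnion fun i =>
      h.hasCompactSupport.isCompact.image (continuous_apply i)).union ?_
    exact 𝒬.isCompact_biUnion fun Q hQ => (h𝒬 Q hQ).1.isCompact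
  have hpB : ∀ p : ι → M, h p ≠ 0 → range p ⊆ B := by
    rintro p hp _ ⟨i, rfl⟩
    exact Or.inl (mem_iUnion.2 ⟨i, p, PointSet.mem_tsupport_of_ne hp, rfl⟩)
  have hfB : ∀ R, PointSet.fiberSum h R ≠ 0 → R ⊆ B := fun R hR => by
    obtain ⟨p, rfl, hp⟩ := PointSet.exists_of_fiberSum_ne_zero hR
    exact hpB p hp
  have key : ∀ Q ∈ 𝒬, _ := fun Q hQ => exists_abs_sum_integral_sub_ncard_copies_le vol (r := r) hr
    (h𝒬 Q hQ).1 (h𝒬 Q hQ).2 (PointSet.continuous_fiberSum_smul h (h𝒬 Q hQ).1) hB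
    (fun m hm => Or.inr (mem_biUnion hQ hm)) hfB
  choose! K hK C hC using key
  refine ⟨K, hK, C, fun P hP D hD => ?_⟩
  have hfin : (P.points ∩ D⁻¹ • B).Finite := P.finite_inter hr (hD.inv.smul_set hB)
  have hfin' : {R : Set M | R ⊆ P.points ∩ D⁻¹ • B ∧ ∃ Q ∈ 𝒬, R ∈ MulAction.orbit T Q}.Finite :=
    hfin.finite_subsets.subset fun R hR => hR.1
  set E := hfin'.toFinset with hE
  have hmem : ∀ R, R ∈ E ↔ R ⊆ P.points ∩ D⁻¹ • B ∧ ∃ Q ∈ 𝒬, R ∈ MulAction.orbit T Q :=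
    fun R => Set.Finite.mem_toFinset _
  have hEfin : ∀ R ∈ E, R.Finite := fun R hR => hfin.subset ((hmem R).1 hR).1
  have hsub : ∀ x ∈ D, ∀ R : Set M, x • R ⊆ B → R ⊆ D⁻¹ • B := fun x hx R hR m hm =>
    ⟨x⁻¹, inv_mem_inv.2 hx, x • m, hR (smul_mem_smul_set hm), inv_smul_smul x m⟩
  have hint : ∫ x in D, PointSet.eval h (PointSet.tuples ι hr (x • P)) ∂vol =
      ∑ R ∈ E, ∫ x in D, PointSet.fiberSum h (x • R) ∂vol := by
    rw [← integral_finsetSum _ fun R hR => (PointSet.continuous_fiberSum_smul h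
      (hEfin R hR)).continuousOn.integrableOn_compact hD]
    refine setIntegral_congr_fun hD.measurableSet fun x hx => ?_
    rw [PointSet.eval_tuples_eq_sum_fiberSum hr h (x • P) (E.image (x • ·)),
      Finset.sum_image (MulAction.injective x).injOn]
    · intro R hR
      obtain ⟨R, hRE, rfl⟩ := Finset.mem_image.1 hR
      exact ⟨(hEfin R hRE).smul_set, smul_set_mono (((hmem R).1 hRE).1.trans inter_subset_left)⟩
    · intro p hp hne
      refine Finset.mem_image.2 ⟨x⁻¹ • range p, (hmem _).2 ⟨subset_inter ?_ (hsub x hx _ ?_), ?_⟩,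
        smul_inv_smul _ _⟩
      · rw [← subset_smul_set_iff]
        rintro _ ⟨i, rfl⟩
        exact hp i
      · rw [smul_inv_smul]
        exact hpB p hne
      · obtain ⟨Q, hQ, hQp⟩ := hP x p hp hne
        exact ⟨Q, hQ, MulAction.mem_orbit_of_mem_orbit _ hQp⟩
  have hsplit : ∑ R ∈ E, ∫ x in D, PointSet.fiberSum h (x • R) ∂vol =
      ∑ Q ∈ 𝒬, ∑ R ∈ E.filter (· ∈ MulAction.orbit T Q),
        ∫ x in D, PointSet.fiberSum h (x • R) ∂vol := by
    rw [← Finset.sum_biUnion]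
    · refine Finset.sum_congr ?_ fun _ _ => rfl
      ext R
      simp only [Finset.mem_biUnion, Finset.mem_filter]
      refine ⟨fun hR => ?_, fun ⟨_, _, hR, _⟩ => hR⟩
      obtain ⟨Q, hQ, hRQ⟩ := ((hmem R).1 hR).2
      exact ⟨Q, hQ, hR, hRQ⟩
    · intro Q hQ Q' hQ' hne
      rw [Function.onFun, Finset.disjoint_left]
      intro R hR hR'
      refine hne (hinj Q' hQ' Q hQ ?_)
      rw [← MulAction.orbit_eq_iff.2 (Finset.mem_filter.1 hR').2]
      exact MulAction.mem_orbit_symm.1 (Finset.mem_filter.1 hR).2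
  rw [hint, hsplit, ← Finset.sum_sub_distrib]
  refine (Finset.abs_sum_le_sum_abs _ _).trans (Finset.sum_le_sum fun Q hQ => ?_)
  refine hC Q hQ P D hD _ (fun R hR => ?_) fun R hR => ?_
  · exact ⟨((hmem R).1 (Finset.mem_filter.1 hR).1).1.trans inter_subset_left,
      (Finset.mem_filter.1 hR).2⟩
  · obtain ⟨hRP, x, hx, hxR⟩ := hR
    have hRQ : R ∈ MulAction.orbit T Q := ⟨x⁻¹, by rw [← hxR]; exact inv_smul_smul x R⟩
    refine Finset.mem_coe.2 (Finset.mem_filter.2 ⟨(hmem R).2 ⟨subset_inter hRP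
      (hsub x hx R ?_), Q, hQ, hRQ⟩, hRQ⟩)
    rw [hxR]
    exact fun m hm => Or.inr (mem_biUnion hQ hm)

variable {vol : Measure T} [vol.IsHaarMeasure] [vol.IsMulRightInvariant]

/-- Along a van Hove sequence, the orbit averages of a sum over tuples become uniformly
indistinguishable from a linear combination of pattern frequencies. -/
theorem IsVanHove.tendstoUniformlyOn_orbitAverage_sub {D : ℕ → Set T} (hD : IsVanHove vol D)
    (hr : 0 < r) (h : C_c(ι → M, ℝ)) (𝒬 : Finset (Set M))
    (h𝒬 : ∀ Q ∈ 𝒬, Q.Finite ∧ Q.Nonempty)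
    (hinj : ∀ Q ∈ 𝒬, ∀ Q' ∈ 𝒬, Q' ∈ MulAction.orbit T Q → Q' = Q) (Ps : Set (PointSet M r))
    (hP : ∀ P ∈ Ps, ∀ x : T, ∀ p ∈ (PointSet.tuples ι hr (x • P)).points, h p ≠ 0 →
      ∃ Q ∈ 𝒬, range p ∈ MulAction.orbit T Q) :
    TendstoUniformlyOn (fun n (yP : T × PointSet M r) =>
      orbitAverage vol (D n) (fun P => PointSet.eval h (PointSet.tuples ι hr P)) (yP.1 • yP.2) -
        ∑ Q ∈ 𝒬, (∫ x : T, PointSet.fiberSum h (x • Q) ∂vol) * patternFreq vol (D n) Q yP.1 yP.2)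
      (fun _ => 0) atTop (univ ×ˢ Ps) := by
  obtain ⟨K, hK, C, hC⟩ := exists_abs_integral_sub_sum_le vol hr h 𝒬 h𝒬 hinj
  have hlim : Tendsto (fun n => ∑ Q ∈ 𝒬, C Q * (vol.real (vanHoveBoundary (K Q) (D n)) /
      vol.real (D n))) atTop (𝓝 (∑ Q ∈ 𝒬, C Q * 0)) :=
    tendsto_finsetSum _ fun Q hQ => (hD.tendsto_boundary _ (hK Q hQ)).const_mul _
  simp only [mul_zero, Finset.sum_const_zero] at hlim
  rw [Metric.tendstoUniformlyOn_iff]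
  intro ε hε
  filter_upwards [(tendsto_order.1 hlim).2 ε hε] with n hn
  rintro ⟨y, P⟩ ⟨-, hPs⟩
  refine lt_of_le_of_lt ?_ hn
  have := hC (y • P) (fun x => by rw [← mul_smul]; exact hP P hPs _) (D n) (hD.isCompact n)
  rw [dist_zero_left, Real.norm_eq_abs]
  simp_rw [patternFreq_eq, orbitAverage, ← mul_div_assoc, ← Finset.sum_div]
  rw [← sub_div, abs_div, abs_of_nonneg (measureReal_nonneg (s := D n))]
  exact div_le_div_of_nonneg_right this measureReal_nonneg

end Counting

/-! ### Finite local complexity -/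

section FLC

variable {M : Type*} [MetricSpace M] [ProperSpace M] {T : Type*} [Group T]
  [MulAction T M] [IsIsometricSMul T M] {r : ℝ}

/-- Up to the group action, the tuples in a given compact set are patterns of a finite list. -/
theorem HasFLC.exists_finite_tuples {Ps : Set (PointSet M r)} (hFLC : HasFLC T Ps) (hr : 0 < r)
    (ι : Type*) [Fintype ι] {B : Set M} (hB : IsCompact B) :
    ∃ 𝓔 : Set (ι → M), 𝓔.Finite ∧ (∀ e ∈ 𝓔, IsPattern Ps (range e)) ∧
      ∀ P ∈ Ps, ∀ x : T, ∀ p ∈ (PointSet.tuples ι hr (x • P)).points, range p ⊆ B →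
        ∃ e ∈ 𝓔, p ∈ MulAction.orbit T e := by
  -- supports only see the interior of a set, so `B` is thickened
  obtain ⟨F, hF, hFp, hcov⟩ := hFLC (Metric.cthickening 1 B) hB.cthickening
  refine ⟨⋃ Q ∈ F, {e | ∀ i, e i ∈ Q}, hF.biUnion fun Q hQ => ?_, fun e he => ?_,
    fun P hP x p hp hpB => ?_⟩
  · obtain ⟨P, -, hQ⟩ := hFp Q hQ
    exact Set.Finite.pi' fun _ => hQ.1
  · obtain ⟨Q, hQ, heQ⟩ := mem_iUnion₂.1 he
    obtain ⟨P, hP, hQfin, hQP⟩ := hFp Q hQ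
    have hsub : range e ⊆ Q := range_subset_iff.2 heQ
    exact ⟨P, hP, hQfin.subset hsub, hsub.trans hQP⟩
  · have hV : IsCompact (x⁻¹ • Metric.cthickening 1 B) := hB.cthickening.smul x⁻¹
    obtain ⟨Q', hQ', z, hz⟩ := hcov P hP (P.points ∩ interior (x⁻¹ • Metric.cthickening 1 B)) _
      ⟨(P.finite_inter hr hV).subset (inter_subset_inter_right _ interior_subset),
        inter_subset_left⟩ ⟨hV, rfl⟩ ⟨x⁻¹, rfl⟩
    refine ⟨z • x⁻¹ • p, mem_biUnion hQ' fun i => ?_, x * z⁻¹, ?_⟩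
    · rw [← hz]
      refine smul_mem_smul_set ⟨?_, ?_⟩
      · exact mem_smul_set_iff_inv_smul_mem.1 (hp i)
      · rw [interior_smul]
        refine smul_mem_smul_set (Metric.thickening_subset_interior_cthickening 1 B ?_)
        exact Metric.self_subset_thickening one_pos B (hpB (mem_range_self i))
    · simp [mul_smul]

end FLC

/-! ### Products of evaluations -/

namespace PointSet

section Products

variable {M : Type*} [MetricSpace M] {ι : Type*} [Fintype ι] {r : ℝ}

/-- The function `p ↦ ∏ i, φ i (p i)` on tuples. -/
noncomputable def tensor (φ : ι → C_c(M, ℝ)) : C_c(ι → M, ℝ) where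
  toFun p := ∏ i, φ i (p i)
  continuous_toFun := continuous_finsetProd _ fun i _ =>
    (φ i).continuous.comp (continuous_apply i)
  hasCompactSupport' := by
    refine HasCompactSupport.intro (K := univ.pi fun i => tsupport (φ i))
      (isCompact_univ_pi fun i => (φ i).hasCompactSupport) fun p hp => ?_
    rw [mem_univ_pi, not_forall] at hp
    obtain ⟨i, hi⟩ := hp
    exact Finset.prod_eq_zero (Finset.mem_univ i) (image_eq_zero_of_notMem_tsupport hi)

theorem range_subset_of_tensor_ne_zero {φ : ι → C_c(M, ℝ)} {p : ι → M} (h : tensor φ p ≠ 0) :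
    range p ⊆ ⋃ i, tsupport (φ i) := by
  rintro _ ⟨i, rfl⟩
  exact mem_iUnion.2 ⟨i, mem_tsupport_of_ne (Finset.prod_ne_zero_iff.1 h i (Finset.mem_univ i))⟩

theorem eval_tensor (hr : 0 < r) (φ : ι → C_c(M, ℝ)) (P : PointSet M r) :
    eval (tensor φ) (tuples ι hr P) = ∏ i, eval (φ i) P := by
  classical
  obtain ⟨F, hF, hFe⟩ := P.exists_finset_eval hr
    (isCompact_iUnion fun i => (φ i).hasCompactSupport.isCompact)
  rw [Finset.prod_congr rfl fun i _ => hFe (φ i) fun p hp =>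
      mem_iUnion.2 ⟨i, mem_tsupport_of_ne hp⟩,
    Finset.prod_univ_sum]
  refine eval_eq_sum _ (fun p hp i => ((hF _).1 (Fintype.mem_piFinset.1 hp i)).1) fun p hp h => ?_
  exact Fintype.mem_piFinset.2 fun i =>
    (hF _).2 ⟨hp i, range_subset_of_tensor_ne_zero h (mem_range_self i)⟩

end Products

end PointSet

/-! ### Isolating the copies of one pattern -/

section Isolating

variable {M : Type*} [MetricSpace M] [ProperSpace M] {T : Type*} [Group T] [TopologicalSpace T]
  [MulAction T M] [ProperSMul T M] [IsIsometricSMul T M] {r : ℝ}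

/-- By finite local complexity, the tuples of elements of the orbits enumerating a set equivalent
to `Q` are separated by closed sets from the other ones. Hence a continuous function of tuples
can be made to vanish on all the latter. -/
theorem HasFLC.exists_isolating (hr : 0 < r) {Ps : Set (PointSet M r)} (hFLC : HasFLC T Ps)
    {Q : Set M} (hQ : Q.Finite) (hQne : Q.Nonempty) [Fintype Q] :
    ∃ h : C_c(Q → M, ℝ), (∀ p, 0 ≤ h p) ∧ 0 < h (fun q : Q => (q : M)) ∧
      ∀ P ∈ Ps, ∀ x : T, ∀ p ∈ (PointSet.tuples Q hr (x • P)).points, h p ≠ 0 →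
        range p ∈ MulAction.orbit T Q := by
  have := hQne.to_subtype
  let φ : Q → C_c(M, ℝ) := fun q => PointSet.tent q 1
  obtain ⟨𝓔, h𝓔, -, hcov⟩ := hFLC.exists_finite_tuples hr Q
    (isCompact_iUnion fun i => (φ i).hasCompactSupport.isCompact)
  set A : Set (Q → M) := {p | range p ∈ MulAction.orbit T Q} with hA
  have hAinv : ∀ (x : T) (p : Q → M), x • p ∈ A ↔ p ∈ A := fun x p => by
    change range (x • p) ∈ MulAction.orbit T Q ↔ range p ∈ MulAction.orbit T Q
    rw [PointSet.range_smul_tuple]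
    refine ⟨fun h => ?_, MulAction.mem_orbit_of_mem_orbit x⟩
    have := MulAction.mem_orbit_of_mem_orbit x⁻¹ h
    rwa [inv_smul_smul] at this
  have hAclosed : IsClosed A := by
    have : A = ⋃ e ∈ {e : Q → M | range e = Q}, range (fun x : T => x • e) := by
      ext p
      simp only [mem_iUnion₂, exists_prop]
      constructor
      · rintro ⟨x, hx⟩
        refine ⟨x⁻¹ • p, ?_, x, smul_inv_smul x p⟩
        change range (x⁻¹ • p) = Q
        rw [PointSet.range_smul_tuple, ← hx]
        exact inv_smul_smul x Q
      · rintro ⟨e, he, x, rfl⟩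
        refine (hAinv x e).2 ?_
        change range e ∈ MulAction.orbit T Q
        rw [show range e = Q from he]
        exact MulAction.mem_orbit_self Q
    rw [this]
    exact (PointSet.finite_setOf_range_eq hQ).isClosed_biUnion fun e _ =>
      isClosed_range_smul_tuple e
  have hA'closed : IsClosed (⋃ e ∈ 𝓔 \ A, range fun x : T => x • e) :=
    h𝓔.sdiff.isClosed_biUnion fun e _ => isClosed_range_smul_tuple e
  obtain ⟨χ, hχ0, hχ1, hχ⟩ := exists_continuous_zero_one_of_isClosed hA'closed hAclosed (by
    rw [disjoint_left]
    rintro p hp hpA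
    obtain ⟨e, he, x, rfl⟩ := mem_iUnion₂.1 hp
    exact he.2 ((hAinv x e).1 hpA))
  refine ⟨⟨χ * (PointSet.tensor φ).toContinuousMap, (PointSet.tensor φ).hasCompactSupport.mul_left⟩,
    fun p => mul_nonneg (hχ p).1 (Finset.prod_nonneg fun i _ => PointSet.tent_nonneg _ _ _), ?_,
    fun P hP x p hp hne => ?_⟩
  · refine mul_pos ?_ (Finset.prod_pos fun i _ => ?_)
    · have : (fun q : Q => (q : M)) ∈ A := by
        change range (Subtype.val : Q → M) ∈ MulAction.orbit T Q
        rw [Subtype.range_val]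
        exact MulAction.mem_orbit_self Q
      rw [hχ1 this]
      exact one_pos
    · exact lt_of_le_of_ne (PointSet.tent_nonneg _ _ _)
        (PointSet.tent_ne_zero_iff.2 (Metric.mem_ball_self one_pos)).symm
  · obtain ⟨e, he, z, rfl⟩ := hcov P hP x p hp
      (PointSet.range_subset_of_tensor_ne_zero (right_ne_zero_of_mul hne))
    refine (hAinv z e).2 ?_
    by_contra heA
    exact left_ne_zero_of_mul hne (hχ0 (mem_biUnion ⟨he, heA⟩ ⟨z, rfl⟩))

end Isolating

/-! ### The hull -/

section Hull

variable {M : Type*} [MetricSpace M] {T : Type*} [Group T] [TopologicalSpace T]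
  [MulAction T M] [ContinuousSMul T M] [IsIsometricSMul T M] {r : ℝ}

theorem smul_mem_hull {Ps : Set (PointSet M r)} {P : PointSet M r} (hP : P ∈ Ps) (y : T) :
    y • P ∈ hull T Ps := subset_closure ⟨y, P, hP, rfl⟩

/-- The union of the orbits in `Ps`, as a subset of the hull. -/
def orbitsIn (T : Type*) {M : Type*} [Group T] [TopologicalSpace T] [MetricSpace M] [MulAction T M]
    [IsIsometricSMul T M] [ContinuousSMul T M] {r : ℝ} (Ps : Set (PointSet M r)) :
    Set (hull T Ps) := {R | ∃ y : T, ∃ P ∈ Ps, R.1 = y • P}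

theorem dense_orbitsIn (Ps : Set (PointSet M r)) : Dense (orbitsIn T Ps) := by
  refine Subtype.dense_iff.2 fun R hR => ?_
  refine closure_mono ?_ (hR : R ∈ closure {R | ∃ x : T, ∃ P ∈ Ps, R = x • P})
  rintro _ ⟨y, P, hP, rfl⟩
  exact ⟨⟨y • P, smul_mem_hull hP y⟩, ⟨y, P, hP, rfl⟩, rfl⟩

variable [ProperSpace M]

/-- The restriction to the hull of the sum of `h` over tuples. -/
noncomputable def hullEval {ι : Type*} [Fintype ι] (hr : 0 < r) (Ps : Set (PointSet M r))
    (h : C_c(ι → M, ℝ)) : C(hull T Ps, ℝ) where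
  toFun R := PointSet.eval h (PointSet.tuples ι hr R.1)
  continuous_toFun := (PointSet.continuous_eval h).comp
    ((PointSet.continuous_tuples hr).comp continuous_subtype_val)

theorem compactSpace_hull (hr : 0 < r) (Ps : Set (PointSet M r)) : CompactSpace (hull T Ps) := by
  have := PointSet.compactSpace (M := M) hr
  exact isCompact_iff_compactSpace.1
    (isClosed_closure (s := {R | ∃ x : T, ∃ P ∈ Ps, R = x • P})).isCompact

theorem metrizableSpace_hull (hr : 0 < r) (Ps : Set (PointSet M r)) :
    TopologicalSpace.MetrizableSpace (hull T Ps) := by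
  have := PointSet.metrizableSpace (M := M) hr
  exact IsEmbedding.subtypeVal.metrizableSpace

end Hull

/-! ### Unique ergodicity and uniform pattern frequencies -/

theorem tendstoUniformlyOn_finsetSum {α β κ : Type*} {l : Filter κ} {s : Set α} {t : Finset β}
    {F : β → κ → α → ℝ} {f : β → α → ℝ} (h : ∀ b ∈ t, TendstoUniformlyOn (F b) (f b) l s) :
    TendstoUniformlyOn (fun n a => ∑ b ∈ t, F b n a) (fun a => ∑ b ∈ t, f b a) l s := by
  classical
  induction t using Finset.induction_on with
  | empty =>
    simp only [Finset.sum_empty]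
    exact Metric.tendstoUniformlyOn_iff.2 fun ε hε => by simp [hε]
  | insert b t hb ih =>
    simp only [Finset.sum_insert hb]
    exact (h b (Finset.mem_insert_self b t)).add
      (ih fun c hc => h c (Finset.mem_insert_of_mem hc))

section Auxiliary

variable {M : Type*} [MetricSpace M] {T : Type*} [Group T] [TopologicalSpace T]
  [MulAction T M] [MeasurableSpace T] [BorelSpace T] {vol : Measure T} [vol.IsHaarMeasure]

theorem tendstoUniformlyOn_patternFreq_empty [IsTopologicalGroup T] [IsIsometricSMul T M]
    [LocallyCompactSpace T] [NoncompactSpace T] {r : ℝ} {D : ℕ → Set T} (hD : IsVanHove vol D)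
    (s : Set (T × PointSet M r)) :
    TendstoUniformlyOn (fun n (yP : T × PointSet M r) => patternFreq vol (D n) ∅ yP.1 yP.2)
      (fun _ => 0) atTop s := by
  -- the empty set is its own only copy
  have h0 := hD.tendsto_measure_atTop.inv_tendsto_atTop
  refine Metric.tendstoUniformlyOn_iff.2 fun ε hε => ?_
  filter_upwards [(tendsto_order.1 h0).2 ε hε] with n hn yP _
  have : copies (D n) ∅ (yP.1 • yP.2).points = {∅} := by
    ext R
    obtain ⟨x, hx⟩ := hD.nonempty n
    exact ⟨fun ⟨_, y, _, h⟩ => smul_set_eq_empty.1 h,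
      fun h => ⟨h ▸ empty_subset _, x, hx, smul_set_eq_empty.2 h⟩⟩
  rw [patternFreq_eq, this, ncard_singleton, dist_zero_left, Nat.cast_one, one_div,
    Real.norm_of_nonneg (inv_nonneg.2 measureReal_nonneg)]
  exact hn

variable [ProperSMul T M]

theorem integral_fiberSum_pos [T2Space T] {ι : Type*} [Fintype ι] {Q : Set M} (hQ : Q.Finite)
    {h : C_c(ι → M, ℝ)} (h0 : ∀ p, 0 ≤ h p) {e : ι → M} (he : range e = Q) (hpos : 0 < h e)
    [Nonempty ι] : 0 < ∫ x : T, PointSet.fiberSum h (x • Q) ∂vol := by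
  obtain ⟨i⟩ := ‹Nonempty ι›
  have hB : IsCompact (⋃ j, (fun p : ι → M => p j) '' tsupport h) :=
    isCompact_iUnion fun j => h.hasCompactSupport.isCompact.image (continuous_apply j)
  have hcont := PointSet.continuous_fiberSum_smul (T := T) h hQ
  refine hcont.integral_pos_of_hasCompactSupport_nonneg_nonzero
    (x := 1) (HasCompactSupport.intro (isCompact_setOf_smul_mem (e i) hB) fun x hx => ?_)
    (fun x => ?_) ?_
  · by_contra hne
    obtain ⟨p, hp, hpne⟩ := PointSet.exists_of_fiberSum_ne_zero hne
    have : x • e i ∈ range p := by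
      rw [hp, ← he]
      exact smul_mem_smul_set (mem_range_self i)
    obtain ⟨j, hj⟩ := this
    exact hx (mem_iUnion.2 ⟨j, p, PointSet.mem_tsupport_of_ne hpne, hj⟩)
  · exact finsum_nonneg fun p => finsum_nonneg fun _ => h0 p
  · rw [one_smul, PointSet.fiberSum_eq_sum h hQ]
    refine (Finset.sum_pos' (fun p _ => h0 p) ⟨e, ?_, hpos⟩).ne'
    exact (Set.Finite.mem_toFinset _).2 he

end Auxiliary

section Main

variable {M : Type*} [MetricSpace M] [ProperSpace M] {T : Type*} [Group T] [TopologicalSpace T]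
  [IsTopologicalGroup T] [T2Space T] [LocallyCompactSpace T]
  [MulAction T M] [ContinuousSMul T M] [ProperSMul T M] [IsIsometricSMul T M]
  [MeasurableSpace T] [BorelSpace T] {r : ℝ} {D : ℕ → Set T}
  {vol : Measure T} [vol.IsHaarMeasure]

/-- Under uniform pattern frequencies the averages of products of evaluations converge, on the
orbits of `Ps`; finite local complexity makes finitely many patterns suffice. -/
theorem HasUniformPatternFrequencies.tendstoUniformlyOn_tensor [vol.IsMulRightInvariant]
    (hD : IsVanHove vol D) (hr : 0 < r) {Ps : Set (PointSet M r)} (hFLC : HasFLC T Ps)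
    (hfreq : HasUniformPatternFrequencies vol D Ps) {ι : Type*} [Fintype ι] [Nonempty ι]
    (φ : ι → C_c(M, ℝ)) : ∃ c : ℝ, TendstoUniformlyOn
      (fun n => orbitAverage vol (D n) (hullEval (T := T) hr Ps (PointSet.tensor φ))) (fun _ => c)
      atTop (orbitsIn T Ps) := by
  obtain ⟨𝓔, h𝓔, h𝓔p, hcov⟩ := hFLC.exists_finite_tuples hr ι
    (isCompact_iUnion fun i => (φ i).hasCompactSupport.isCompact)
  -- one representative per orbit, itself a pattern of `Ps`
  obtain ⟨𝒬, h𝒬, hbij⟩ := exists_subset_bijOn (range '' 𝓔) fun Q => MulAction.orbit T Q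
  have hfin : 𝒬.Finite := (h𝓔.image _).subset h𝒬
  have hpat : ∀ Q ∈ hfin.toFinset, IsPattern Ps Q ∧ Q.Nonempty := fun Q hQ => by
    obtain ⟨e, he, rfl⟩ := h𝒬 (hfin.mem_toFinset.1 hQ)
    exact ⟨h𝓔p e he, range_nonempty e⟩
  have hdiff := hD.tendstoUniformlyOn_orbitAverage_sub hr (PointSet.tensor φ) hfin.toFinset
    (fun Q hQ => ⟨(hpat Q hQ).1.choose_spec.2.1, (hpat Q hQ).2⟩)
    (fun Q hQ Q' hQ' h => hbij.injOn (hfin.mem_toFinset.1 hQ') (hfin.mem_toFinset.1 hQ)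
      (MulAction.orbit_eq_iff.2 h)) Ps (fun P hP x p hp hne => by
        obtain ⟨e, he, z, hz⟩ := hcov P hP x p hp (PointSet.range_subset_of_tensor_ne_zero hne)
        obtain ⟨Q, hQ, hQe⟩ := hbij.surjOn (mem_image_of_mem _ (mem_image_of_mem range he))
        refine ⟨Q, hfin.mem_toFinset.2 hQ, ?_⟩
        change MulAction.orbit T Q = _ at hQe
        rw [hQe, ← hz]
        exact ⟨z, (PointSet.range_smul_tuple z e).symm⟩)
  choose! ν hν using hfreq
  have hsum : TendstoUniformlyOn (fun n (yP : T × PointSet M r) => ∑ Q ∈ hfin.toFinset,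
      (∫ x : T, PointSet.fiberSum (PointSet.tensor φ) (x • Q) ∂vol) *
        patternFreq vol (D n) Q yP.1 yP.2) (fun _ => ∑ Q ∈ hfin.toFinset,
      (∫ x : T, PointSet.fiberSum (PointSet.tensor φ) (x • Q) ∂vol) * ν Q) atTop (univ ×ˢ Ps) := by
    refine tendstoUniformlyOn_finsetSum fun Q hQ => ?_
    exact (uniformContinuous_const_smul
      (∫ x : T, PointSet.fiberSum (PointSet.tensor φ) (x • Q) ∂vol)).comp_tendstoUniformlyOn
        (hν Q (hpat Q hQ).1)
  refine ⟨∑ Q ∈ hfin.toFinset, (∫ x : T, PointSet.fiberSum (PointSet.tensor φ) (x • Q) ∂vol) * ν Q,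
    Metric.tendstoUniformlyOn_iff.2 fun ε hε => ?_⟩
  filter_upwards [Metric.tendstoUniformlyOn_iff.1 (hdiff.add hsum) ε hε] with n hn
  rintro ⟨R, hR⟩ ⟨y, P, hP, h⟩
  change R = y • P at h
  subst h
  have := hn (y, P) ⟨mem_univ _, hP⟩
  simp only [Pi.add_apply, sub_add_cancel, zero_add] at this
  exact this

theorem HasUniformPatternFrequencies.uniquelyErgodic [TopologicalSpace.MetrizableSpace T]
    [SecondCountableTopology T] [vol.IsMulRightInvariant]
    (hD : IsVanHove vol D) (hr : 0 < r) {Ps : Set (PointSet M r)} (hne : Ps.Nonempty)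
    (hFLC : HasFLC T Ps) (hfreq : HasUniformPatternFrequencies vol D Ps) :
    UniquelyErgodic T (hull T Ps) := by
  have := PointSet.continuousSMul (T := T) (M := M) hr
  have := metrizableSpace_hull (T := T) hr Ps
  have := compactSpace_hull (T := T) hr Ps
  have : Nonempty (hull T Ps) := by
    obtain ⟨P, hP⟩ := hne
    exact ⟨⟨(1 : T) • P, smul_mem_hull hP 1⟩⟩
  let F : C_c(M, ℝ) → C(hull T Ps, ℝ) := fun φ =>
    ⟨fun R => PointSet.eval φ R.1, (PointSet.continuous_eval φ).comp continuous_subtype_val⟩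
  refine hD.uniquelyErgodic_of_tendstoUniformlyOn (Algebra.adjoin ℝ (range F)) ?_
    (dense_orbitsIn Ps) ?_
  · intro R R' hRR'
    by_contra hcon
    refine hRR' (Subtype.ext (PointSet.exists_dense_separating hr dense_univ fun m _ n => ?_))
    by_contra hne
    exact hcon ⟨_, ⟨F (PointSet.tent m (1 / (n + 1))),
      Algebra.subset_adjoin (mem_range_self _), rfl⟩, hne⟩
  · have hprod : ∀ f ∈ Submonoid.closure (range F), ∃ (ι : Type) (_ : Fintype ι)
        (φ : ι → C_c(M, ℝ)), ∀ R, f R = ∏ i, PointSet.eval (φ i) R.1 := by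
      intro f hf
      induction hf using Submonoid.closure_induction with
      | mem f hf =>
        obtain ⟨φ, rfl⟩ := hf
        exact ⟨Unit, inferInstance, fun _ => φ, fun R => by simp [F]⟩
      | one => exact ⟨Empty, inferInstance, Empty.elim, fun R => by simp⟩
      | mul f g _ _ hf hg =>
        obtain ⟨ι, _, φ, hφ⟩ := hf
        obtain ⟨κ, _, ψ, hψ⟩ := hg
        exact ⟨ι ⊕ κ, inferInstance, Sum.elim φ ψ, fun R => by simp [hφ, hψ]⟩
    intro f hf
    rw [← Subalgebra.mem_toSubmodule, Algebra.adjoin_eq_span] at hf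
    induction hf using Submodule.span_induction with
    | mem f hf =>
      obtain ⟨ι, _, φ, hφ⟩ := hprod f hf
      rcases isEmpty_or_nonempty ι with hι | hι
      · refine ⟨1, ?_⟩
        have h1 : ∀ R, f R = 1 := fun R => by rw [hφ, Finset.prod_of_isEmpty]
        refine Metric.tendstoUniformlyOn_iff.2 fun ε hε => ?_
        filter_upwards [hD.eventually_pos] with n hn R hR
        simp only [orbitAverage, h1, setIntegral_const, smul_eq_mul, mul_one]
        rwa [div_self hn.ne', dist_self]
      · have : f = hullEval hr Ps (PointSet.tensor φ) := by
          ext R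
          rw [hφ]
          exact (PointSet.eval_tensor hr φ R.1).symm
        rw [this]
        exact hfreq.tendstoUniformlyOn_tensor hD hr hFLC φ
    | zero =>
      refine ⟨0, Metric.tendstoUniformlyOn_iff.2 fun ε hε => Eventually.of_forall fun n R _ => ?_⟩
      simpa [orbitAverage] using hε
    | add f g _ _ hf hg =>
      obtain ⟨c, hc⟩ := hf
      obtain ⟨d, hd⟩ := hg
      refine ⟨c + d, (hc.add hd).congr (Eventually.of_forall fun n R _ => ?_)⟩
      exact (orbitAverage_add (hD.isCompact n) f g R).symm
    | smul a f _ hf =>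
      obtain ⟨c, hc⟩ := hf
      refine ⟨a * c, ((uniformContinuous_const_smul a).comp_tendstoUniformlyOn hc).congr
        (Eventually.of_forall fun n R _ => ?_)⟩
      exact (orbitAverage_smul vol (D n) a f R).symm

theorem UniquelyErgodic.hasUniformPatternFrequencies [TopologicalSpace.MetrizableSpace T]
    [SecondCountableTopology T] [NoncompactSpace T] [vol.IsMulRightInvariant]
    (hD : IsVanHove vol D) (hr : 0 < r) {Ps : Set (PointSet M r)}
    (hFLC : HasFLC T Ps) (hX : UniquelyErgodic T (hull T Ps)) :
    HasUniformPatternFrequencies vol D Ps := by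
  rintro Q ⟨P₀, -, hQ, -⟩
  rcases Q.eq_empty_or_nonempty with rfl | hQne
  · exact ⟨0, tendstoUniformlyOn_patternFreq_empty hD _⟩
  have := PointSet.continuousSMul (T := T) (M := M) hr
  have := metrizableSpace_hull (T := T) hr Ps
  have := compactSpace_hull (T := T) hr Ps
  have := hQ.fintype
  have := hQne.to_subtype
  obtain ⟨h, h0, hpos, hiso⟩ := hFLC.exists_isolating hr hQ hQne
  have hc : 0 < ∫ x : T, PointSet.fiberSum h (x • Q) ∂vol :=
    integral_fiberSum_pos hQ h0 Subtype.range_val hpos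
  obtain ⟨a, ha⟩ := hX.tendstoUniformly_orbitAverage hD (hullEval (T := T) hr Ps h)
  have hdiff := hD.tendstoUniformlyOn_orbitAverage_sub hr h {Q} (by simpa using ⟨hQ, hQne⟩)
    (by simp) Ps (fun P hP x p hp hne => ⟨Q, Finset.mem_singleton_self Q, hiso P hP x p hp hne⟩)
  simp only [Finset.sum_singleton] at hdiff
  set c := ∫ x : T, PointSet.fiberSum h (x • Q) ∂vol with hcdef
  refine ⟨a / c, Metric.tendstoUniformlyOn_iff.2 fun ε hε => ?_⟩
  have hε' : 0 < c * ε / 2 := by positivity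
  filter_upwards [Metric.tendstoUniformly_iff.1 ha _ hε',
    Metric.tendstoUniformlyOn_iff.1 hdiff _ hε'] with n h1 h2
  rintro ⟨y, P⟩ ⟨-, hP⟩
  have h1 := h1 ⟨y • P, smul_mem_hull hP y⟩
  have h2 := h2 (y, P) ⟨mem_univ _, hP⟩
  change dist a (orbitAverage vol (D n)
    (fun P => PointSet.eval h (PointSet.tuples Q hr P)) (y • P)) < _ at h1
  simp only [Real.dist_eq] at h1 h2 ⊢
  set f := patternFreq vol (D n) Q y P
  have h3 : |a - c * f| < c * ε := by
    rw [abs_lt] at *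
    constructor <;> linarith
  have : a / c - f = (a - c * f) / c := by field_simp
  rwa [this, abs_div, abs_of_pos hc, div_lt_iff₀ hc, mul_comm ε]

end Main

theorem proposition2p16
    {M : Type*} [MetricSpace M] [ProperSpace M] [Nonempty M]
    {T : Type*} [Group T] [TopologicalSpace T] [IsTopologicalGroup T]
    [TopologicalSpace.MetrizableSpace T] [NoncompactSpace T]
    [MulAction T M] [ContinuousSMul T M] [ProperSMul T M] [IsIsometricSMul T M]
    [MeasurableSpace T] [BorelSpace T]
    -- a left Haar measure; right invariance says that `T` is unimodular
    (vol : Measure T) [vol.IsHaarMeasure] [vol.IsMulRightInvariant]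
    (D : ℕ → Set T) (hD : IsVanHove vol D)
    (r : ℝ) (hr : 0 < r)
    (Ps : Set (PointSet M r)) (hne : Ps.Nonempty) (hFLC : HasFLC T Ps) :
    UniquelyErgodic T (hull T Ps) ↔ HasUniformPatternFrequencies vol D Ps := by
  have := locallyCompactSpace_of_properSMul (T := T) (M := M)
  have := secondCountableTopology_of_properSMul (T := T) (M := M)
  exact ⟨fun h => h.hasUniformPatternFrequencies hD hr hFLC,
    fun h => h.uniquelyErgodic hD hr hne hFLC⟩
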